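/- For $n\ge 1$ put $N=2^n$; logarithms are to base 2. For $f:\{0,1\}^n\to\{-1,1\}$ and $z\in\{0,1\}^n$ let $$\widehat f(z)=2^{-n/2}\sum_{x\in\{0,1\}^n} f(x)(-1)^{x\cdot z},\qquad \mathsf{adv}(f)=2^{-n}\sum_{z:\,|\widehat f(z)|\ge 1}\widehat f(z)^2,$$ and let $$\mathsf{Succ}_Q=\frac{2}{\sqrt{2\pi}}\int_1^\infty x^2e^{-x^2/2}\,dx\approx 0.801,\qquad \mathsf{Succ}_R=\frac{2}{\sqrt{2\pi}}\int_1^\infty e^{-x^2/2}\,dx\approx 0.317.$$ A randomized $T$-query algorithm is a probability distribution over deterministic adaptive algorithms (decision trees) that, given oracle access to $f$, make at most $T$ queries to $f$ on every $f$ and output a string in $\{0,1\}^n$. (1) (promise-Fourier Fishing) No randomized algorithm making $o(N/\log N)$ queries finds, on every $f$ with $\mathsf{adv}(f)\ge \mathsf{Succ}_Q-\frac1n$, a string $z$ with $|\widehat f(z)|\ge 1$ with probability $\mathsf{Succ}_R+\Omega(1)$. Precisely: if $T(n)=o(N/\log N)$ and, for each $n$, $A_n$ is a randomized $T(n)$-query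 algorithm, then for every constant $c>0$ and all sufficiently large $n$ there is an $f:\{0,1\}^n\to\{-1,1\}$ with $\mathsf{adv}(f)\ge \mathsf{Succ}_Q-\frac1n$ on which $A_n$ outputs some $z$ with $|\widehat f(z)|\ge 1$ with probability less than $\mathsf{Succ}_R+c$. (2) (Fourier Sampling with large error) For every $\varepsilon<\mathsf{Succ}_Q-\mathsf{Succ}_R\approx 0.483$ the randomized query complexity of Fourier Sampling with error $\varepsilon$ is $\Omega(N/\log N)$. Precisely: there is a constant $c=c(\varepsilon)>0$ such that for all sufficiently large $n$, every randomized $T$-query algorithm whose output distribution, on every $f:\{0,1\}^n\to\{-1,1\}$, is within total variation distance $\varepsilon$ of the distribution $z\mapsto 2^{-n}\widehat f(z)^2$ satisfies $T\ge c\,N/\log N$. -/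

import Mathlib

open Filter Asymptotics

/-- The set `{0,1}^n` of bit strings of length `n`; bits are elements of `ZMod 2`. -/
abbrev BitString (n : ℕ) : Type := Fin n → ZMod 2

/-- Oracles: functions `f : {0,1}^n → {-1,1}`; the set `{-1,1}` is the unit group of `ℤ`. -/
abbrev Oracle (n : ℕ) : Type := BitString n → ℤˣ

/-- The sign `(-1)^{x·z}`, where `x·z` is the inner product modulo 2. -/
def parityChar {n : ℕ} (x z : BitString n) : ℝ := (-1) ^ (x ⬝ᵥ z).val

/-- The Fourier coefficient `2^{-n/2} ∑_x f(x) (-1)^{x·z}`. -/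
noncomputable def fourierCoeff01 {n : ℕ} (f : Oracle n) (z : BitString n) : ℝ :=
  (∑ x, ((f x : ℤ) : ℝ) * parityChar x z) / Real.sqrt ((2 : ℝ) ^ n)

/-- The weight `2^{-n} f̂(z)^2` of `z` in the output distribution of Fourier Sampling. -/
noncomputable def fourierWeight {n : ℕ} (f : Oracle n) (z : BitString n) : ℝ :=
  fourierCoeff01 f z ^ 2 / (2 : ℝ) ^ n

/-- `z` is a correct answer to Fourier Fishing on `f`. -/
def IsHeavy {n : ℕ} (f : Oracle n) (z : BitString n) : Prop := 1 ≤ |fourierCoeff01 f z|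

open Classical in
/-- `adv(f) = 2^{-n} ∑_{z : |f̂(z)| ≥ 1} f̂(z)^2`. -/
noncomputable def adv {n : ℕ} (f : Oracle n) : ℝ :=
  (∑ z with IsHeavy f z, fourierCoeff01 f z ^ 2) / (2 : ℝ) ^ n

noncomputable def succQ : ℝ :=
  2 / Real.sqrt (2 * Real.pi) * ∫ x in Set.Ioi (1 : ℝ), x ^ 2 * Real.exp (-x ^ 2 / 2)

noncomputable def succR : ℝ :=
  2 / Real.sqrt (2 * Real.pi) * ∫ x in Set.Ioi (1 : ℝ), Real.exp (-x ^ 2 / 2)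

/-- The promise of promise-Fourier Fishing. -/
def FishingPromise {n : ℕ} (f : Oracle n) : Prop := succQ - 1 / (n : ℝ) ≤ adv f

/-- Deterministic adaptive query algorithms on oracles `{0,1}^n → {-1,1}` with output in
`{0,1}^n`: either stop with an output, or query a point and continue depending on the answer. -/
inductive QueryTree (n : ℕ) : Type
  | output (z : BitString n) : QueryTree n
  | query (x : BitString n) (next : ℤˣ → QueryTree n) : QueryTree n

namespace QueryTree

/-- The output of the algorithm when run on the oracle `f`. -/
def run {n : ℕ} (f : Oracle n) : QueryTree n → BitString n
  | output z => z
  | query x next => run f (next (f x))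

/-- The number of queries the algorithm makes when run on the oracle `f`. -/
def numQueries {n : ℕ} (f : Oracle n) : QueryTree n → ℕ
  | output _ => 0
  | query x next => numQueries f (next (f x)) + 1

end QueryTree

/-- A randomized query algorithm: a probability distribution over deterministic ones. -/
abbrev RandQueryAlg (n : ℕ) : Type := PMF (QueryTree n)

namespace RandQueryAlg

/-- For every oracle and every outcome of the internal randomness (of positive probability),
at most `T` queries are made. -/
def MakesAtMost {n : ℕ} (A : RandQueryAlg n) (T : ℕ) : Prop :=
  ∀ t ∈ A.support, ∀ f : Oracle n, t.numQueries f ≤ T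

/-- The distribution of the output on the oracle `f`. -/
noncomputable def outputDist {n : ℕ} (A : RandQueryAlg n) (f : Oracle n) : PMF (BitString n) :=
  A.map (QueryTree.run f)

open Classical in
/-- The probability that the output on the oracle `f` is a correct answer to Fourier Fishing. -/
noncomputable def fishingProb {n : ℕ} (A : RandQueryAlg n) (f : Oracle n) : ℝ :=
  ∑ z with IsHeavy f z, (A.outputDist f z).toReal

/-- The total variation distance between the output distribution on the oracle `f` and the
distribution `z ↦ 2^{-n} f̂(z)^2`. -/
noncomputable def samplingError {n : ℕ} (A : RandQueryAlg n) (f : Oracle n) : ℝ :=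
  (1 / 2) * ∑ z, |(A.outputDist f z).toReal - fourierWeight f z|

/-- `A` solves Fourier Sampling with error `ε` on every oracle. -/
def SolvesFourierSampling {n : ℕ} (A : RandQueryAlg n) (ε : ℝ) : Prop :=
  ∀ f : Oracle n, A.samplingError f ≤ ε

end RandQueryAlg

/-! Both bounds come from a uniformly random oracle `f`. Each Fourier coefficient is then a
normalized sum of N independent signs, hence nearly a standard Gaussian; `succQ` and `succR` are the
Gaussian values of the second moment and of the probability on |x| ≥ 1.

The promise holds for almost all `f`. By Parseval, `adv f` is at least 1 minus the average of a
smooth truncated square over the coefficients. Lindeberg's replacement argument gives the mean of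
such an average (`abs_expect_fourierCoeff01_sub_le`), and the Poincaré inequality combined with
Parseval bounds its variance by O(1/N) for a fixed test function (`variance_coeffAvg_le`); Chebyshev
finishes (`eventually_expect_not_promise_le`).

A tree with at most κN/n queries learns almost nothing about any coefficient: by an adaptive
Chernoff bound and a union bound over all `z`, the queried points contribute at most δ to each of
them. Resampling `f` at the queried points therefore moves the coefficient at the output by at most
2δ, while the resampled oracle is uniform and independent of the output
(`QueryTree.expect_run_exchange`). So the output is heavy with probability about `succR`
(`exists_eventually_expect_isHeavy_le`). Averaging over trees and discarding the few oracles outside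
the promise yields a bad oracle inside it.

A sampler with error ε solves Fishing on `f` with probability at least `adv f` - ε, so the second
bound follows from the first argument. -/

/-- Negation of one coordinate of a point of the sign cube. -/
def flipAt {ι : Type*} [DecidableEq ι] (x : ι) (f : ι → ℤˣ) : ι → ℤˣ :=
  Function.update f x (-f x)

/-! ### Poincaré inequality on the sign cube -/

section Cube

open Finset BigOperators

variable {ι : Type*} [DecidableEq ι]

@[simp] lemma flipAt_same (x : ι) (f : ι → ℤˣ) : flipAt x f x = -f x := by
  simp [flipAt]

lemma flipAt_of_ne {x y : ι} (h : y ≠ x) (f : ι → ℤˣ) : flipAt x f y = f y := by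
  simp [flipAt, h]

@[simp] lemma flipAt_flipAt (x : ι) (f : ι → ℤˣ) : flipAt x (flipAt x f) = f := by
  funext y
  by_cases h : y = x
  · subst h; simp
  · simp [flipAt_of_ne h]

lemma flipAt_comm (x y : ι) (f : ι → ℤˣ) : flipAt x (flipAt y f) = flipAt y (flipAt x f) := by
  by_cases h : x = y
  · subst h; rfl
  · funext z
    by_cases hx : z = x
    · subst hx
      rw [flipAt_same, flipAt_of_ne h, flipAt_of_ne h, flipAt_same]
    · rw [flipAt_of_ne hx]
      by_cases hy : z = y
      · subst hy; rw [flipAt_same, flipAt_same, flipAt_of_ne hx]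
      · rw [flipAt_of_ne hy, flipAt_of_ne hy, flipAt_of_ne hx]

variable [Fintype ι]

lemma expect_flipAt (x : ι) (F : (ι → ℤˣ) → ℝ) : 𝔼 f, F (flipAt x f) = 𝔼 f, F f :=
  Fintype.expect_equiv (Function.Involutive.toPerm (flipAt x) (flipAt_flipAt x)) _ _
    fun _ => rfl

lemma expect_eq_expect_flip_avg (x : ι) (F : (ι → ℤˣ) → ℝ) :
    𝔼 f, F f = 𝔼 f, (F f + F (flipAt x f)) / 2 := by
  rw [← expect_div, expect_add_distrib, expect_flipAt]
  ring

/-- The Poincaré inequality on the sign cube, for functions of the coordinates in `s`. -/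
lemma poincare_of_depends (s : Finset ι) : ∀ F : (ι → ℤˣ) → ℝ,
    (∀ x ∉ s, ∀ f, F (flipAt x f) = F f) →
    𝔼 f, F f ^ 2 - (𝔼 f, F f) ^ 2 ≤ (∑ x ∈ s, 𝔼 f, (F f - F (flipAt x f)) ^ 2) / 4 := by
  induction s using Finset.induction_on with
  | empty =>
    intro F hF
    have hc : ∀ f, F f = F 1 := by
      -- Any point is reached from 1 by flips; the induction is on a set containing all coordinates
      -- where `f` is -1.
      have key : ∀ (s : Finset ι) (f : ι → ℤˣ), (∀ x ∉ s, f x = 1) → F f = F 1 := by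
        intro s
        induction s using Finset.induction_on with
        | empty =>
          intro f hf
          congr 1
          funext x
          exact hf x (by simp)
        | insert a s ha ih =>
          intro f hf
          rcases Int.units_eq_one_or (f a) with h1 | h1
          · refine ih f fun x hx => ?_
            by_cases hxa : x = a
            · rw [hxa, h1]
            · exact hf x (by simp [hxa, hx])
          · rw [← hF a (by simp) f]
            refine ih _ fun x hx => ?_
            by_cases hxa : x = a
            · subst hxa; simp [h1]
            · rw [flipAt_of_ne hxa]
              exact hf x (by simp [hxa, hx])
      exact fun f => key univ f (by simp)
    simp [hc]
  | insert a s ha ih =>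
    intro F hF
    -- `M` is the conditional expectation over coordinate `a`: the variance of `F` is that of `M`
    -- plus a quarter of the influence of `a`, and by convexity averaging increases no influence.
    set M : (ι → ℤˣ) → ℝ := fun f => (F f + F (flipAt a f)) / 2 with hM
    have hMinv : ∀ x ∉ s, ∀ f, M (flipAt x f) = M f := by
      intro x hx f
      by_cases hxa : x = a
      · subst hxa; simp only [hM, flipAt_flipAt]; ring
      · have hx' : x ∉ insert a s := by simp [hxa, hx]
        simp only [hM]
        rw [hF x hx', flipAt_comm, hF x hx']
    have h1 := ih M hMinv
    have hEM : 𝔼 f, M f = 𝔼 f, F f := (expect_eq_expect_flip_avg a F).symm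
    have hsq : 𝔼 f, F f ^ 2 = 𝔼 f, M f ^ 2 + (𝔼 f, (F f - F (flipAt a f)) ^ 2) / 4 := by
      rw [expect_eq_expect_flip_avg a (fun f => F f ^ 2), expect_div, ← expect_add_distrib]
      refine expect_congr rfl fun f _ => ?_
      simp only [hM]; ring
    have hterm : ∀ x, 𝔼 f, (M f - M (flipAt x f)) ^ 2 ≤ 𝔼 f, (F f - F (flipAt x f)) ^ 2 := by
      intro x
      rw [expect_eq_expect_flip_avg a (fun f => (F f - F (flipAt x f)) ^ 2)]
      refine expect_le_expect fun f _ => ?_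
      simp only [hM]
      rw [flipAt_comm a x]
      nlinarith [sq_nonneg ((F f - F (flipAt x f)) - (F (flipAt a f) - F (flipAt x (flipAt a f))))]
    rw [sum_insert ha, hsq, ← hEM]
    have := sum_le_sum fun x (_ : x ∈ s) => hterm x
    linarith

lemma poincare (F : (ι → ℤˣ) → ℝ) :
    𝔼 f, F f ^ 2 - (𝔼 f, F f) ^ 2 ≤ (∑ x, 𝔼 f, (F f - F (flipAt x f)) ^ 2) / 4 :=
  poincare_of_depends univ F (by simp)

end Cube

/-! ### Characters of the Boolean group and Parseval -/

section Characters

open Finset BigOperators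

variable {n : ℕ}

lemma parityChar_comm (x z : BitString n) : parityChar x z = parityChar z x := by
  simp [parityChar, dotProduct_comm]

lemma neg_one_pow_val_add (a b : ZMod 2) :
    ((-1 : ℝ)) ^ (a + b).val = (-1) ^ a.val * (-1) ^ b.val := by
  rw [← pow_add, neg_one_pow_eq_pow_mod_two, neg_one_pow_eq_pow_mod_two (n := a.val + b.val),
    ZMod.val_add]
  simp

lemma parityChar_add_right (x z w : BitString n) :
    parityChar x (z + w) = parityChar x z * parityChar x w := by
  simp [parityChar, dotProduct_add, neg_one_pow_val_add]

lemma parityChar_sq (x z : BitString n) : parityChar x z ^ 2 = 1 := by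
  rw [parityChar, ← pow_mul, mul_comm, pow_mul]; simp

lemma parityChar_eq_or (x z : BitString n) : parityChar x z = 1 ∨ parityChar x z = -1 := by
  rw [parityChar]; exact neg_one_pow_eq_or ℝ _

lemma parityChar_zero_left (z : BitString n) : parityChar 0 z = 1 := by
  simp [parityChar]

/-- Translation by a `w` whose character value is -1 negates the sum. -/
lemma sum_parityChar_eq_zero {x : BitString n} (hx : x ≠ 0) : ∑ z, parityChar x z = 0 := by
  obtain ⟨i, hi⟩ : ∃ i, x i ≠ 0 := by
    by_contra! h; exact hx (funext h)
  have h1 : x i = 1 := by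
    have h2 : ∀ a : ZMod 2, a ≠ 0 → a = 1 := by decide
    exact h2 _ hi
  have hneg : parityChar x (Pi.single i 1) = -1 := by
    simp [parityChar, h1, ZMod.val_one]
  generalize (Pi.single i 1 : BitString n) = w at hneg
  have : ∑ z, parityChar x (z + w) = ∑ z, parityChar x z :=
    Fintype.sum_equiv (Equiv.addRight w) _ _ fun _ => rfl
  simp only [parityChar_add_right, hneg, ← sum_mul] at this
  linarith

lemma card_bitString : (Fintype.card (BitString n) : ℝ) = 2 ^ n := by
  simp [BitString, ZMod.card]

lemma sum_parityChar_mul (x y : BitString n) :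
    ∑ z, parityChar x z * parityChar y z = if x = y then (2 : ℝ) ^ n else 0 := by
  have h : ∀ z, parityChar x z * parityChar y z = parityChar (x + y) z := by
    intro z
    rw [parityChar_comm x, parityChar_comm y, parityChar_comm (x + y), parityChar_add_right]
  simp only [h]
  split_ifs with hxy
  · subst hxy
    rw [show x + x = 0 by funext i; exact CharTwo.add_self_eq_zero (x i)]
    simp only [parityChar_zero_left, sum_const, card_univ, nsmul_eq_mul, mul_one, card_bitString]
  · refine sum_parityChar_eq_zero fun h0 => hxy ?_
    funext i
    exact CharTwo.add_eq_zero.1 (congrFun h0 i)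

/-- Parseval's identity for the characters of `{0,1}^n`. -/
lemma sum_sq_sum_mul_parityChar (a : BitString n → ℝ) :
    ∑ z, (∑ x, a x * parityChar x z) ^ 2 = 2 ^ n * ∑ x, a x ^ 2 := by
  calc ∑ z, (∑ x, a x * parityChar x z) ^ 2
      = ∑ z, ∑ x, ∑ y, a x * a y * (parityChar x z * parityChar y z) := by
        refine sum_congr rfl fun z _ => ?_
        rw [sq, sum_mul_sum]
        exact sum_congr rfl fun x _ => sum_congr rfl fun y _ => by ring
    _ = ∑ x, ∑ y, a x * a y * ∑ z, parityChar x z * parityChar y z := by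
        rw [sum_comm]
        refine sum_congr rfl fun x _ => ?_
        rw [sum_comm]
        exact sum_congr rfl fun y _ => by rw [mul_sum]
    _ = 2 ^ n * ∑ x, a x ^ 2 := by
        simp only [sum_parityChar_mul, mul_ite, mul_zero, sum_ite_eq, mem_univ, if_true, mul_sum]
        exact sum_congr rfl fun x _ => by ring

lemma units_cast_sq (u : ℤˣ) : (((u : ℤ) : ℝ)) ^ 2 = 1 := by
  rcases Int.units_eq_one_or u with h | h <;> simp [h]

lemma sum_fourierCoeff01_sq (f : Oracle n) : ∑ z, fourierCoeff01 f z ^ 2 = 2 ^ n := by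
  have h2 : (0 : ℝ) < 2 ^ n := by positivity
  simp only [fourierCoeff01, div_pow, Real.sq_sqrt h2.le, ← sum_div, sum_sq_sum_mul_parityChar,
    units_cast_sq, sum_const, card_univ, nsmul_eq_mul, mul_one, card_bitString]
  field_simp

end Characters

/-! ### Smooth test functions with explicit derivative bounds -/

section Smooth

open Real

/-- `u` is three times differentiable, and `u` and its first three derivatives are bounded
by `L`. -/
def SmoothBound (L : ℝ) (u : ℝ → ℝ) : Prop :=
  ∃ u₁ u₂ u₃ : ℝ → ℝ, (∀ x, HasDerivAt u (u₁ x) x) ∧ (∀ x, HasDerivAt u₁ (u₂ x) x) ∧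
    (∀ x, HasDerivAt u₂ (u₃ x) x) ∧
    ∀ x, |u x| ≤ L ∧ |u₁ x| ≤ L ∧ |u₂ x| ≤ L ∧ |u₃ x| ≤ L

namespace SmoothBound

variable {L M : ℝ} {u v : ℝ → ℝ}

lemma nonneg (h : SmoothBound L u) : 0 ≤ L := by
  obtain ⟨u₁, u₂, u₃, -, -, -, hb⟩ := h
  exact (abs_nonneg _).trans (hb 0).1

lemma continuous (h : SmoothBound L u) : Continuous u := by
  obtain ⟨u₁, u₂, u₃, h1, -⟩ := h
  exact continuous_iff_continuousAt.2 fun x => (h1 x).continuousAt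

lemma abs_le (h : SmoothBound L u) (x : ℝ) : |u x| ≤ L := by
  obtain ⟨u₁, u₂, u₃, -, -, -, hb⟩ := h
  exact (hb x).1

/-- The third derivative of a product expands into 8 terms, each at most `L * M`; lower orders have
fewer. -/
lemma mul (hu : SmoothBound L u) (hv : SmoothBound M v) :
    SmoothBound (8 * L * M) (fun x => u x * v x) := by
  have hL := hu.nonneg
  have hM := hv.nonneg
  obtain ⟨u₁, u₂, u₃, hu1, hu2, hu3, hub⟩ := hu
  obtain ⟨v₁, v₂, v₃, hv1, hv2, hv3, hvb⟩ := hv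
  refine ⟨fun x => u₁ x * v x + u x * v₁ x,
    fun x => (u₂ x * v x + u₁ x * v₁ x) + (u₁ x * v₁ x + u x * v₂ x),
    fun x => ((u₃ x * v x + u₂ x * v₁ x) + (u₂ x * v₁ x + u₁ x * v₂ x)) +
      ((u₂ x * v₁ x + u₁ x * v₂ x) + (u₁ x * v₂ x + u x * v₃ x)),
    fun x => (hu1 x).mul (hv1 x),
    fun x => ((hu2 x).mul (hv1 x)).add ((hu1 x).mul (hv2 x)),
    fun x => (((hu3 x).mul (hv1 x)).add ((hu2 x).mul (hv2 x))).add
      (((hu2 x).mul (hv2 x)).add ((hu1 x).mul (hv3 x))), fun x => ?_⟩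
  obtain ⟨a0, a1, a2, a3⟩ := hub x
  obtain ⟨b0, b1, b2, b3⟩ := hvb x
  have key : ∀ {a b : ℝ}, |a| ≤ L → |b| ≤ M → -(L * M) ≤ a * b ∧ a * b ≤ L * M := by
    intro a b ha hb
    rw [← _root_.abs_le, abs_mul]
    exact mul_le_mul ha hb (abs_nonneg _) hL
  have hLM : 0 ≤ L * M := mul_nonneg hL hM
  refine ⟨?_, ?_, ?_, ?_⟩
  · have := key a0 b0
    rw [_root_.abs_le]; constructor <;> linarith
  · have := key a1 b0
    have := key a0 b1
    rw [_root_.abs_le]; constructor <;> linarith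
  · have := key a2 b0
    have := key a1 b1
    have := key a0 b2
    rw [_root_.abs_le]; constructor <;> linarith
  · have := key a3 b0
    have := key a2 b1
    have := key a1 b2
    have := key a0 b3
    rw [_root_.abs_le]; constructor <;> linarith

lemma comp_affine (hu : SmoothBound L u) {a : ℝ} (ha : 1 ≤ |a|) (b : ℝ) :
    SmoothBound (L * |a| ^ 3) (fun x => u (a * x + b)) := by
  have hL := hu.nonneg
  obtain ⟨u₁, u₂, u₃, hu1, hu2, hu3, hub⟩ := hu
  have haff : ∀ x, HasDerivAt (fun x => a * x + b) a x := fun x => by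
    simpa using ((hasDerivAt_id x).const_mul a).add_const b
  have step : ∀ {w w' : ℝ → ℝ}, (∀ x, HasDerivAt w (w' x) x) → ∀ (c x : ℝ),
      HasDerivAt (fun x => w (a * x + b) * c) (w' (a * x + b) * (a * c)) x := by
    intro w w' hw c x
    have := ((hw (a * x + b)).comp x (haff x)).mul_const c
    rwa [mul_assoc] at this
  refine ⟨fun x => u₁ (a * x + b) * a, fun x => u₂ (a * x + b) * (a * a),
    fun x => u₃ (a * x + b) * (a * (a * a)), fun x => ?_, step hu2 a, step hu3 (a * a),
    fun x => ?_⟩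
  · simpa using step hu1 1 x
  · obtain ⟨a0, a1, a2, a3⟩ := hub (a * x + b)
    have h1 : 1 ≤ |a| ^ 3 := one_le_pow₀ ha
    have h2 : |a| ≤ |a| ^ 3 := le_self_pow₀ ha (by norm_num)
    have h3 : |a| * |a| ≤ |a| ^ 3 := by
      rw [← sq]; exact pow_le_pow_right₀ ha (by norm_num)
    simp only [abs_mul]
    refine ⟨a0.trans (le_mul_of_one_le_right hL h1), mul_le_mul a1 h2 (abs_nonneg _) hL,
      mul_le_mul a2 h3 (by positivity) hL, mul_le_mul a3 (le_of_eq (by ring)) (by positivity) hL⟩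

end SmoothBound

lemma exists_smoothBound_of_hasCompactSupport_deriv {u : ℝ → ℝ} (hu : ContDiff ℝ 3 u)
    {C : ℝ} (hC : ∀ x, |u x| ≤ C) (hd : HasCompactSupport (deriv u)) :
    ∃ L, SmoothBound L u := by
  have c1 : ContDiff ℝ 2 (deriv u) := hu.deriv'
  have c2 : ContDiff ℝ 1 (deriv (deriv u)) := c1.deriv'
  have c3 : ContDiff ℝ 0 (deriv (deriv (deriv u))) := c2.deriv'
  obtain ⟨C1, h1⟩ := hd.exists_bound_of_continuous c1.continuous
  obtain ⟨C2, h2⟩ := hd.deriv.exists_bound_of_continuous c2.continuous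
  obtain ⟨C3, h3⟩ := hd.deriv.deriv.exists_bound_of_continuous c3.continuous
  refine ⟨max (max C C1) (max C2 C3), deriv u, deriv (deriv u), deriv (deriv (deriv u)),
    fun x => (hu.differentiable (by norm_num) x).hasDerivAt,
    fun x => (c1.differentiable (by norm_num) x).hasDerivAt,
    fun x => (c2.differentiable (by norm_num) x).hasDerivAt, fun x => ⟨?_, ?_, ?_, ?_⟩⟩
  · exact (hC x).trans ((le_max_left _ _).trans (le_max_left _ _))
  · exact (h1 x).trans ((le_max_right _ _).trans (le_max_left _ _))
  · exact (h2 x).trans ((le_max_left _ _).trans (le_max_right _ _))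
  · exact (h3 x).trans ((le_max_right _ _).trans (le_max_right _ _))

lemma exists_smoothBound_smoothTransition : ∃ L, SmoothBound L smoothTransition := by
  refine exists_smoothBound_of_hasCompactSupport_deriv smoothTransition.contDiff (C := 1)
    (fun x => ?_) (HasCompactSupport.intro (isCompact_Icc (a := (0 : ℝ)) (b := 1)) ?_)
  · rw [abs_of_nonneg (smoothTransition.nonneg x)]
    exact smoothTransition.le_one x
  · intro x hx
    rcases lt_or_ge x 0 with h | h
    · have : smoothTransition =ᶠ[nhds x] fun _ => 0 := by
        filter_upwards [Iio_mem_nhds h] with y hy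
        exact smoothTransition.zero_of_nonpos (le_of_lt hy)
      rw [this.deriv_eq]; simp
    · have h' : 1 < x := by
        by_contra h1
        exact hx ⟨h, not_lt.1 h1⟩
      have : smoothTransition =ᶠ[nhds x] fun _ => 1 := by
        filter_upwards [Ioi_mem_nhds h'] with y hy
        exact smoothTransition.one_of_one_le (le_of_lt hy)
      rw [this.deriv_eq]; simp

/-- A smooth function, equal to `1` on `|x| ≤ a - δ` and to `0` on `|x| ≥ a`. -/
noncomputable def plateau (a δ x : ℝ) : ℝ :=
  smoothTransition ((a - x) / δ) * smoothTransition ((a + x) / δ)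

lemma plateau_nonneg (a δ x : ℝ) : 0 ≤ plateau a δ x :=
  mul_nonneg (smoothTransition.nonneg _) (smoothTransition.nonneg _)

lemma plateau_le_one (a δ x : ℝ) : plateau a δ x ≤ 1 :=
  mul_le_one₀ (smoothTransition.le_one _) (smoothTransition.nonneg _) (smoothTransition.le_one _)

lemma plateau_eq_one {a δ x : ℝ} (hδ : 0 < δ) (hx : |x| ≤ a - δ) : plateau a δ x = 1 := by
  have := abs_le.1 hx
  rw [plateau, smoothTransition.one_of_one_le, smoothTransition.one_of_one_le, mul_one]
  · rw [le_div_iff₀ hδ]; linarith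
  · rw [le_div_iff₀ hδ]; linarith

lemma plateau_eq_zero {a δ x : ℝ} (hδ : 0 < δ) (hx : a ≤ |x|) : plateau a δ x = 0 := by
  rcases le_abs.1 hx with h | h
  · rw [plateau, smoothTransition.zero_of_nonpos, zero_mul]
    exact div_nonpos_of_nonpos_of_nonneg (by linarith) hδ.le
  · rw [plateau, mul_comm, smoothTransition.zero_of_nonpos, zero_mul]
    exact div_nonpos_of_nonpos_of_nonneg (by linarith) hδ.le

/-- Each of the two factors costs δ⁻³. The loss is polynomial in 1/δ and uniform in `a`, so δ of
order 1/n is affordable against errors exponentially small in n. -/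
lemma exists_smoothBound_plateau :
    ∃ C, 0 ≤ C ∧ ∀ a δ : ℝ, 0 < δ → δ ≤ 1 → SmoothBound (C / δ ^ 6) (plateau a δ) := by
  obtain ⟨L, hL⟩ := exists_smoothBound_smoothTransition
  refine ⟨8 * L * L, mul_nonneg (mul_nonneg (by norm_num) hL.nonneg) hL.nonneg,
    fun a δ hδ hδ1 => ?_⟩
  have h1 : 1 ≤ |δ⁻¹| := by
    rw [abs_of_pos (inv_pos.2 hδ)]; exact (one_le_inv₀ hδ).2 hδ1
  have h2 : 1 ≤ |-δ⁻¹| := by rwa [abs_neg]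
  have := (hL.comp_affine h2 (a / δ)).mul (hL.comp_affine h1 (a / δ))
  convert this using 1
  · rw [abs_neg, abs_of_pos (inv_pos.2 hδ)]
    field_simp
  · funext x
    rw [plateau]
    congr 2 <;> ring

/-- A smooth truncation of `x ^ 2` to the interval `|x| < 1 + δ`. -/
noncomputable def truncSq (δ x : ℝ) : ℝ :=
  -- The middle factor is 1 on |x| ≤ 2; it makes the part independent of δ bounded with bounded
  -- derivatives.
  x ^ 2 * plateau 3 1 x * plateau (1 + δ) δ x

lemma exists_smoothBound_truncSq :
    ∃ C, 0 ≤ C ∧ ∀ δ : ℝ, 0 < δ → δ ≤ 1 → SmoothBound (C / δ ^ 6) (truncSq δ) := by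
  obtain ⟨C, hC0, hC⟩ := exists_smoothBound_plateau
  have hq : ∃ L, SmoothBound L (fun x => x ^ 2 * plateau 3 1 x) := by
    have hs : HasCompactSupport (fun x : ℝ => x ^ 2 * plateau 3 1 x) :=
      HasCompactSupport.intro (isCompact_Icc (a := (-3 : ℝ)) (b := 3)) fun x hx => by
        rw [plateau_eq_zero one_pos, mul_zero]
        by_contra h
        exact hx (abs_le.1 (not_le.1 h).le)
    have hc : ContDiff ℝ 3 (fun x : ℝ => x ^ 2 * plateau 3 1 x) := by
      unfold plateau
      have h3 : ContDiff ℝ 3 smoothTransition := smoothTransition.contDiff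
      exact (contDiff_id.pow 2).mul ((h3.comp (by fun_prop)).mul (h3.comp (by fun_prop)))
    obtain ⟨K, hK⟩ := hs.exists_bound_of_continuous hc.continuous
    exact exists_smoothBound_of_hasCompactSupport_deriv hc hK hs.deriv
  obtain ⟨L, hL⟩ := hq
  refine ⟨8 * L * C, mul_nonneg (mul_nonneg (by norm_num) hL.nonneg) hC0, fun δ hδ hδ1 => ?_⟩
  rw [mul_div_assoc]
  exact hL.mul (hC (1 + δ) δ hδ hδ1)

lemma truncSq_nonneg (δ x : ℝ) : 0 ≤ truncSq δ x :=
  mul_nonneg (mul_nonneg (sq_nonneg _) (plateau_nonneg _ _ _)) (plateau_nonneg _ _ _)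

lemma truncSq_of_abs_le_one {δ x : ℝ} (hδ : 0 < δ) (hx : |x| ≤ 1) : truncSq δ x = x ^ 2 := by
  rw [truncSq, plateau_eq_one one_pos (by linarith), plateau_eq_one hδ (by linarith)]
  ring

lemma truncSq_eq_zero {δ x : ℝ} (hδ : 0 < δ) (hx : 1 + δ ≤ |x|) : truncSq δ x = 0 := by
  rw [truncSq, plateau_eq_zero hδ hx, mul_zero]

lemma truncSq_le_sq (δ x : ℝ) : truncSq δ x ≤ x ^ 2 := by
  rw [truncSq, mul_assoc]
  exact mul_le_of_le_one_right (sq_nonneg x)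
    (mul_le_one₀ (plateau_le_one _ _ _) (plateau_nonneg _ _ _) (plateau_le_one _ _ _))

end Smooth

/-! ### Taylor estimates -/

section Taylor

/-- Mean value inequality on the ball of radius |y|. Iterating it gives Taylor remainders without
the factorials, which are not needed. -/
lemma abs_le_mul_abs_pow_of_deriv {g g' : ℝ → ℝ} (hg : ∀ t, HasDerivAt g (g' t) t) (h0 : g 0 = 0)
    {C : ℝ} (hC : 0 ≤ C) (k : ℕ) (hb : ∀ t, |g' t| ≤ C * |t| ^ k) (y : ℝ) :
    |g y| ≤ C * |y| ^ (k + 1) := by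
  have := (convex_closedBall (0 : ℝ) |y|).norm_image_sub_le_of_norm_hasDerivWithin_le
    (f := g) (f' := g') (C := C * |y| ^ k) (x := 0) (y := y)
    (fun t _ => (hg t).hasDerivWithinAt)
    (fun t ht => by
      refine (hb t).trans (mul_le_mul_of_nonneg_left ?_ hC)
      refine pow_le_pow_left₀ (abs_nonneg _) ?_ _
      simpa using ht)
    (by simp) (by simp)
  rw [h0, sub_zero, sub_zero, Real.norm_eq_abs, Real.norm_eq_abs] at this
  rwa [pow_succ, ← mul_assoc]

/-- Taylor's formula with remainder of order two. -/
lemma abs_taylor_one_le {u u₁ u₂ : ℝ → ℝ} (h1 : ∀ x, HasDerivAt u (u₁ x) x)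
    (h2 : ∀ x, HasDerivAt u₁ (u₂ x) x) {L : ℝ} (hb : ∀ x, |u₂ x| ≤ L) (x y : ℝ) :
    |u (x + y) - u x - u₁ x * y| ≤ L * |y| ^ 2 := by
  have hL : 0 ≤ L := (abs_nonneg _).trans (hb 0)
  have shift : ∀ {w w' : ℝ → ℝ}, (∀ x, HasDerivAt w (w' x) x) → ∀ t,
      HasDerivAt (fun y => w (x + y) - w x) (w' (x + t)) t := fun hw t =>
    ((hw (x + t)).comp_const_add x t).sub_const _
  have e1 : ∀ t, |u₁ (x + t) - u₁ x| ≤ L * |t| ^ 1 :=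
    abs_le_mul_abs_pow_of_deriv (g := fun t => u₁ (x + t) - u₁ x) (shift h2) (by simp) hL 0
      (fun t => by simpa using hb (x + t))
  refine abs_le_mul_abs_pow_of_deriv (g := fun y => u (x + y) - u x - u₁ x * y)
    (g' := fun t => u₁ (x + t) - u₁ x) (fun t => ?_) (by simp) hL 1 e1 y
  exact ((shift h1 t).sub ((hasDerivAt_id t).const_mul (u₁ x))).congr_deriv (by simp)

/-- Taylor's formula with remainder of order three. -/
lemma abs_taylor_two_le {u u₁ u₂ u₃ : ℝ → ℝ} (h1 : ∀ x, HasDerivAt u (u₁ x) x)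
    (h2 : ∀ x, HasDerivAt u₁ (u₂ x) x) (h3 : ∀ x, HasDerivAt u₂ (u₃ x) x)
    {L : ℝ} (hb : ∀ x, |u₃ x| ≤ L) (x y : ℝ) :
    |u (x + y) - u x - u₁ x * y - u₂ x / 2 * y ^ 2| ≤ L * |y| ^ 3 := by
  have hL : 0 ≤ L := (abs_nonneg _).trans (hb 0)
  refine abs_le_mul_abs_pow_of_deriv
    (g := fun y => u (x + y) - u x - u₁ x * y - u₂ x / 2 * y ^ 2)
    (g' := fun t => u₁ (x + t) - u₁ x - u₂ x * t) (fun t => ?_) (by simp) hL 2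
    (abs_taylor_one_le h2 h3 hb x) y
  have e := ((((h1 (x + t)).comp_const_add x t).sub_const (u x)).sub
    ((hasDerivAt_id t).const_mul (u₁ x))).sub (((hasDerivAt_id t).pow 2).const_mul (u₂ x / 2))
  refine e.congr_deriv ?_
  simp only [id, mul_one, Nat.cast_ofNat]
  ring

end Taylor

/-! ### Central limit theorem by Lindeberg replacement -/

section Lindeberg

open MeasureTheory ProbabilityTheory Finset BigOperators

open scoped NNReal

/-- The third absolute moment of the standard Gaussian. -/
noncomputable def gaussianThirdMoment : ℝ := ∫ y, |y| ^ 3 ∂gaussianReal 0 1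

lemma integrable_pow_abs_gaussianReal (k : ℕ) (v : ℝ≥0) :
    Integrable (fun y : ℝ => |y| ^ k) (gaussianReal 0 v) := by
  have := (memLp_id_gaussianReal (μ := 0) (v := v) (k : ℝ≥0)).integrable_norm_pow'
  simpa using this

lemma integrable_pow_gaussianReal (k : ℕ) (v : ℝ≥0) :
    Integrable (fun y : ℝ => y ^ k) (gaussianReal 0 v) := by
  refine (integrable_pow_abs_gaussianReal k v).mono (by fun_prop) ?_
  exact ae_of_all _ fun y => by simp

lemma integral_sq_gaussianReal (v : ℝ≥0) : ∫ y, y ^ 2 ∂gaussianReal 0 v = v := by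
  have := variance_id_gaussianReal (μ := 0) (v := v)
  rw [variance_eq_sub (memLp_id_gaussianReal 2)] at this
  simpa using this

lemma gaussianReal_sq_eq_map {h : ℝ} :
    gaussianReal 0 (Real.toNNReal (h ^ 2)) = (gaussianReal 0 1).map (h * ·) := by
  rw [gaussianReal_map_const_mul]
  congr 1
  · simp
  · ext; simp [sq_nonneg]

lemma integral_abs_cube_gaussianReal {h : ℝ} (hh : 0 ≤ h) :
    ∫ y, |y| ^ 3 ∂gaussianReal 0 (Real.toNNReal (h ^ 2)) = h ^ 3 * gaussianThirdMoment := by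
  rw [gaussianReal_sq_eq_map, integral_map (by fun_prop) (by fun_prop), gaussianThirdMoment,
    ← integral_const_mul]
  refine integral_congr_ae (ae_of_all _ fun y => ?_)
  simp only [abs_mul, abs_of_nonneg hh]
  ring

/-- The average of `u` over the two points at distance `h`. -/
noncomputable def signStep (h : ℝ) (u : ℝ → ℝ) (x : ℝ) : ℝ := (u (x + h) + u (x - h)) / 2

lemma SmoothBound.signStep {L : ℝ} {u : ℝ → ℝ} (hu : SmoothBound L u) (h : ℝ) :
    SmoothBound L (signStep h u) := by
  obtain ⟨u₁, u₂, u₃, h1, h2, h3, hb⟩ := hu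
  have step : ∀ {w w' : ℝ → ℝ}, (∀ x, HasDerivAt w (w' x) x) → ∀ x,
      HasDerivAt (_root_.signStep h w) (_root_.signStep h w' x) x := fun hw x =>
    (((hw (x + h)).comp_add_const x h).add ((hw (x - h)).comp_sub_const x h)).div_const 2
  have bd : ∀ {w : ℝ → ℝ}, (∀ x, |w x| ≤ L) → ∀ x, |_root_.signStep h w x| ≤ L := by
    intro w hw x
    have a := _root_.abs_le.1 (hw (x + h))
    have b := _root_.abs_le.1 (hw (x - h))
    rw [_root_.signStep, _root_.abs_le]
    constructor <;> linarith
  exact ⟨_, _, _, step h1, step h2, step h3, fun x => ⟨bd (fun x => (hb x).1) x,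
    bd (fun x => (hb x).2.1) x, bd (fun x => (hb x).2.2.1) x, bd (fun x => (hb x).2.2.2) x⟩⟩

lemma SmoothBound.iterate_signStep {L : ℝ} {u : ℝ → ℝ} (hu : SmoothBound L u) (h : ℝ) (k : ℕ) :
    SmoothBound L ((_root_.signStep h)^[k] u) := by
  induction k with
  | zero => exact hu
  | succ k ih => rw [Function.iterate_succ_apply']; exact ih.signStep h

lemma SmoothBound.integrable {L : ℝ} {u : ℝ → ℝ} (hu : SmoothBound L u) (μ : Measure ℝ)
    [IsFiniteMeasure μ] : Integrable u μ :=
  Integrable.of_bound hu.continuous.aestronglyMeasurable L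
    (ae_of_all _ fun x => by simpa using hu.abs_le x)

lemma SmoothBound.comp_const_add {L : ℝ} {u : ℝ → ℝ} (hu : SmoothBound L u) (x : ℝ) :
    SmoothBound L (fun y => u (x + y)) := by
  have := hu.comp_affine (a := 1) (by simp) x
  simpa [add_comm] using this

/-- One Lindeberg replacement step. -/
lemma abs_integral_gaussian_sub_signStep_le {L : ℝ} {u : ℝ → ℝ} (hu : SmoothBound L u) {h : ℝ}
    (hh : 0 ≤ h) (x : ℝ) :
    |∫ y, u (x + y) ∂gaussianReal 0 (Real.toNNReal (h ^ 2)) - signStep h u x| ≤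
      L * (1 + gaussianThirdMoment) * h ^ 3 := by
  have hint := (hu.comp_const_add x).integrable (gaussianReal 0 (Real.toNNReal (h ^ 2)))
  obtain ⟨u₁, u₂, u₃, h1, h2, h3, hb⟩ := hu
  have T := abs_taylor_two_le h1 h2 h3 (fun x => (hb x).2.2.2) x
  set μ := gaussianReal 0 (Real.toNNReal (h ^ 2)) with hμ
  have i1 : Integrable (fun y : ℝ => y) μ := by
    simpa using integrable_pow_gaussianReal 1 (Real.toNNReal (h ^ 2))
  have i2 : Integrable (fun y : ℝ => y ^ 2) μ := integrable_pow_gaussianReal 2 _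
  have e1 : |∫ y, (u (x + y) - u x - u₁ x * y - u₂ x / 2 * y ^ 2) ∂μ| ≤
      L * (h ^ 3 * gaussianThirdMoment) := by
    rw [← integral_abs_cube_gaussianReal hh, ← integral_const_mul, ← Real.norm_eq_abs]
    exact norm_integral_le_of_norm_le ((integrable_pow_abs_gaussianReal 3 _).const_mul L)
      (ae_of_all _ fun y => T y)
  have e2 : ∫ y, (u (x + y) - u x - u₁ x * y - u₂ x / 2 * y ^ 2) ∂μ =
      ∫ y, u (x + y) ∂μ - u x - u₂ x / 2 * h ^ 2 := by
    have j1 : Integrable (fun y => u (x + y) - u x) μ := hint.sub (integrable_const _)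
    have j2 : Integrable (fun y => u (x + y) - u x - u₁ x * y) μ := j1.sub (i1.const_mul _)
    rw [integral_sub j2 (i2.const_mul _), integral_sub j1 (i1.const_mul _),
      integral_sub hint (integrable_const _), integral_const_mul, integral_const_mul,
      integral_sq_gaussianReal, integral_id_gaussianReal]
    simp [sq_nonneg]
  rw [e2] at e1
  -- In the average over ±h the linear terms cancel and the quadratic term equals the Gaussian one,
  -- so only cubic errors remain.
  have t1 := T h
  have t2 := T (-h)
  rw [abs_neg, abs_of_nonneg hh, ← sub_eq_add_neg] at t2
  rw [abs_of_nonneg hh] at t1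
  rw [abs_le] at e1 t1 t2 ⊢
  simp only [signStep]
  constructor <;> nlinarith

/-- Signs are traded one at a time for Gaussians of variance h²; each new Gaussian is absorbed into
`w` by convolution, which is why the induction needs every `w`. -/
lemma abs_integral_iterate_signStep_sub_le {L : ℝ} {u : ℝ → ℝ} (hu : SmoothBound L u) {h : ℝ}
    (hh : 0 ≤ h) (k : ℕ) : ∀ w : ℝ≥0,
    |∫ x, (signStep h)^[k] u x ∂gaussianReal 0 w -
      ∫ x, u x ∂gaussianReal 0 (w + k * Real.toNNReal (h ^ 2))| ≤
      k * (L * (1 + gaussianThirdMoment) * h ^ 3) := by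
  induction k with
  | zero => intro w; simp
  | succ k ih =>
    intro w
    set v := Real.toNNReal (h ^ 2) with hv
    have hU := hu.iterate_signStep h k
    set U := (signStep h)^[k] u with hUdef
    have hconv : ∫ x, U x ∂gaussianReal 0 (w + v) =
        ∫ x, ∫ y, U (x + y) ∂gaussianReal 0 v ∂gaussianReal 0 w := by
      have e : gaussianReal 0 (w + v) = (gaussianReal 0 w).conv (gaussianReal 0 v) := by
        rw [gaussianReal_conv_gaussianReal, add_zero]
      rw [e, integral_conv]
      rw [← e]; exact hU.integrable _
    have hprod : Integrable (fun x => ∫ y, U (x + y) ∂gaussianReal 0 v) (gaussianReal 0 w) := by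
      refine Integrable.of_bound (C := L) ?_ (ae_of_all _ fun x => ?_)
      · have hc : StronglyMeasurable (fun p : ℝ × ℝ => U (p.1 + p.2)) :=
          (hU.continuous.comp continuous_add).stronglyMeasurable
        exact hc.integral_prod_right'.aestronglyMeasurable
      · refine (norm_integral_le_of_norm_le_const (C := L)
          (ae_of_all _ fun y => hU.abs_le _)).trans ?_
        simp
    have step : |∫ x, signStep h U x ∂gaussianReal 0 w - ∫ x, U x ∂gaussianReal 0 (w + v)| ≤
        L * (1 + gaussianThirdMoment) * h ^ 3 := by
      rw [hconv, ← integral_sub ((hU.signStep h).integrable _) hprod, ← Real.norm_eq_abs]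
      refine (norm_integral_le_of_norm_le_const
        (C := L * (1 + gaussianThirdMoment) * h ^ 3) (ae_of_all _ fun x => ?_)).trans
        (le_of_eq (by simp))
      rw [Real.norm_eq_abs, abs_sub_comm]
      exact abs_integral_gaussian_sub_signStep_le hU hh x
    have rest := ih (w + v)
    rw [Function.iterate_succ_apply', ← hUdef]
    have ew : w + ((k + 1 : ℕ) : ℝ≥0) * v = w + v + k * v := by push_cast; ring
    rw [ew]
    refine (abs_sub_le _ (∫ x, U x ∂gaussianReal 0 (w + v)) _).trans
      ((add_le_add step rest).trans (le_of_eq ?_))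
    push_cast; ring

variable {ι : Type*} [DecidableEq ι] [Fintype ι]

/-- Averaging over one coordinate applies `signStep` once; the sign `c x` does not affect this
average. -/
lemma expect_signSum_eq_iterate {c : ι → ℝ} (hc : ∀ x, c x = 1 ∨ c x = -1) (h a : ℝ)
    (s : Finset ι) : ∀ u : ℝ → ℝ,
    𝔼 f : ι → ℤˣ, u (a + h * ∑ x ∈ s, ((f x : ℤ) : ℝ) * c x) = (signStep h)^[s.card] u a := by
  induction s using Finset.induction_on with
  | empty => intro u; simp
  | insert y s hy ih =>
    intro u
    rw [card_insert_of_notMem hy, Function.iterate_succ_apply, ← ih,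
      expect_eq_expect_flip_avg y]
    refine expect_congr rfl fun f _ => ?_
    have hs : ∑ x ∈ s, ((flipAt y f x : ℤ) : ℝ) * c x = ∑ x ∈ s, ((f x : ℤ) : ℝ) * c x :=
      sum_congr rfl fun x hx => by rw [flipAt_of_ne (ne_of_mem_of_not_mem hx hy)]
    simp only [sum_insert hy, hs, flipAt_same, signStep]
    generalize ∑ x ∈ s, ((f x : ℤ) : ℝ) * c x = S
    have e1 : a + h * (1 + S) = a + h * S + h := by ring
    have e2 : a + h * (-1 + S) = a + h * S - h := by ring
    rcases Int.units_eq_one_or (f y) with hf | hf <;> rcases hc y with hcy | hcy <;>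
      simp [hf, hcy, e1, e2, add_comm (u (a + h * S - h))]

/-- A quantitative central limit theorem for signed sums and smooth test functions. -/
lemma abs_expect_signSum_sub_integral_le {L : ℝ} {u : ℝ → ℝ} (hu : SmoothBound L u) {c : ι → ℝ}
    (hc : ∀ x, c x = 1 ∨ c x = -1) {h : ℝ} (hh : 0 ≤ h) (hN : Fintype.card ι * h ^ 2 = 1) :
    |𝔼 f : ι → ℤˣ, u (h * ∑ x, ((f x : ℤ) : ℝ) * c x) - ∫ x, u x ∂gaussianReal 0 1| ≤
      L * (1 + gaussianThirdMoment) * h := by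
  have e := expect_signSum_eq_iterate hc h 0 univ u
  simp only [zero_add] at e
  rw [e, card_univ]
  -- Variance 0 is the Dirac mass at 0, so the left integral is the iterate evaluated at 0.
  have key := abs_integral_iterate_signStep_sub_le hu hh (Fintype.card ι) 0
  have hv : 0 + (Fintype.card ι : ℝ≥0) * Real.toNNReal (h ^ 2) = 1 := by
    ext
    simp [sq_nonneg, hN]
  rw [hv, gaussianReal_zero_var, integral_dirac] at key
  refine key.trans (le_of_eq ?_)
  calc (Fintype.card ι : ℝ) * (L * (1 + gaussianThirdMoment) * h ^ 3)
      = (Fintype.card ι * h ^ 2) * (L * (1 + gaussianThirdMoment) * h) := by ring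
    _ = _ := by rw [hN, one_mul]

end Lindeberg

/-! ### Gaussian integrals of the test functions -/

section GaussianIntegrals

open MeasureTheory ProbabilityTheory

open scoped Classical in
lemma integral_gaussian_tail_pow (k : ℕ) :
    ∫ x, (if 1 ≤ |x| then |x| ^ k else 0) ∂gaussianReal 0 1 =
      2 / Real.sqrt (2 * Real.pi) * ∫ x in Set.Ioi (1 : ℝ), x ^ k * Real.exp (-x ^ 2 / 2) := by
  rw [integral_gaussianReal_eq_integral_smul one_ne_zero]
  have e : ∀ x : ℝ, gaussianPDFReal 0 1 x • (if 1 ≤ |x| then |x| ^ k else 0) =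
      (Set.Ici (1 : ℝ)).indicator
        (fun t => (Real.sqrt (2 * Real.pi))⁻¹ * (t ^ k * Real.exp (-t ^ 2 / 2))) |x| := by
    intro x
    by_cases h : 1 ≤ |x|
    · simp [h, gaussianPDFReal]
      ring
    · simp [h]
  simp only [e]
  rw [integral_comp_abs (f := (Set.Ici (1 : ℝ)).indicator
        (fun t => (Real.sqrt (2 * Real.pi))⁻¹ * (t ^ k * Real.exp (-t ^ 2 / 2)))),
    setIntegral_indicator measurableSet_Ici,
    Set.inter_eq_self_of_subset_right (Set.Ici_subset_Ioi.2 one_pos),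
    integral_Ici_eq_integral_Ioi, integral_const_mul]
  ring

open scoped Classical in
lemma integral_gaussian_tail_one :
    ∫ x, (if 1 ≤ |x| then (1 : ℝ) else 0) ∂gaussianReal 0 1 = succR := by
  simpa [succR] using integral_gaussian_tail_pow 0

open scoped Classical in
lemma integral_gaussian_tail_sq :
    ∫ x, (if 1 ≤ |x| then x ^ 2 else 0) ∂gaussianReal 0 1 = succQ := by
  simpa [succQ] using integral_gaussian_tail_pow 2

lemma gaussianPDFReal_le_one (x : ℝ) : gaussianPDFReal 0 1 x ≤ 1 := by
  rw [gaussianPDFReal]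
  refine mul_le_one₀ (inv_le_one_of_one_le₀ ?_) (Real.exp_nonneg _) ?_
  · rw [Real.one_le_sqrt]
    have := Real.pi_gt_three
    simp only [NNReal.coe_one]; linarith
  · rw [Real.exp_le_one_iff]
    simp only [NNReal.coe_one, sub_zero]
    have := sq_nonneg x
    linarith

lemma gaussianReal_Icc_le {a b : ℝ} (hab : a ≤ b) :
    (gaussianReal 0 1).real (Set.Icc a b) ≤ b - a := by
  have h : gaussianReal 0 1 (Set.Icc a b) ≤ ENNReal.ofReal (b - a) := by
    rw [gaussianReal_apply 0 one_ne_zero, ← Real.volume_Icc]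
    calc ∫⁻ x in Set.Icc a b, gaussianPDF 0 1 x ≤ ∫⁻ _ in Set.Icc a b, 1 := by
          refine lintegral_mono fun x => ?_
          rw [gaussianPDF]
          exact ENNReal.ofReal_le_one.2 (gaussianPDFReal_le_one x)
      _ = _ := by simp
  exact ENNReal.toReal_le_of_le_ofReal (by linarith) h

lemma gaussianReal_band_le {a b : ℝ} (hab : a ≤ b) :
    (gaussianReal 0 1).real {x | a ≤ |x| ∧ |x| ≤ b} ≤ 2 * (b - a) := by
  have hs : {x : ℝ | a ≤ |x| ∧ |x| ≤ b} ⊆ Set.Icc a b ∪ Set.Icc (-b) (-a) := by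
    rintro x ⟨h1, h2⟩
    have := abs_le.1 h2
    rcases le_abs.1 h1 with h | h
    · exact Or.inl ⟨h, this.2⟩
    · exact Or.inr ⟨this.1, by linarith⟩
  have h1 := gaussianReal_Icc_le hab
  have h2 := gaussianReal_Icc_le (neg_le_neg hab)
  have h3 := (measureReal_mono hs (μ := gaussianReal 0 1)).trans (measureReal_union_le _ _)
  linarith

lemma measurableSet_band (a b : ℝ) : MeasurableSet {x : ℝ | a ≤ |x| ∧ |x| ≤ b} :=
  ((isClosed_le continuous_const continuous_abs).inter
    (isClosed_le continuous_abs continuous_const)).measurableSet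

lemma integrable_indicator_band (a b c : ℝ) :
    Integrable ({x : ℝ | a ≤ |x| ∧ |x| ≤ b}.indicator fun _ => c) (gaussianReal 0 1) :=
  (integrable_const c).indicator (measurableSet_band a b)

open scoped Classical in
lemma integrable_gaussian_tail_pow (k : ℕ) :
    Integrable (fun x : ℝ => if 1 ≤ |x| then x ^ k else 0) (gaussianReal 0 1) := by
  have : (fun x : ℝ => if 1 ≤ |x| then x ^ k else 0) =
      {x : ℝ | 1 ≤ |x|}.indicator (fun x => x ^ k) := by
    funext x; simp [Set.indicator]
  rw [this]
  exact (integrable_pow_gaussianReal k 1).indicator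
    (isClosed_le continuous_const continuous_abs).measurableSet

/-- The truncation exceeds the square cut off at 1 only on the band 1 ≤ |x| ≤ 1 + δ, where it is at
most 4 and whose mass is at most 2δ. -/
lemma integral_truncSq_le {δ : ℝ} (hδ : 0 < δ) (hδ1 : δ ≤ 1) :
    ∫ x, truncSq δ x ∂gaussianReal 0 1 ≤ 1 - succQ + 8 * δ := by
  classical
  obtain ⟨C, -, hC⟩ := exists_smoothBound_truncSq
  have hb := gaussianReal_band_le (a := 1) (b := 1 + δ) (by linarith)
  have hint : Integrable (fun x : ℝ => x ^ 2 - (if 1 ≤ |x| then x ^ 2 else 0))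
      (gaussianReal 0 1) :=
    (integrable_pow_gaussianReal 2 1).sub (integrable_gaussian_tail_pow 2)
  calc ∫ x, truncSq δ x ∂gaussianReal 0 1
      ≤ ∫ x, (x ^ 2 - (if 1 ≤ |x| then x ^ 2 else 0) +
          {x : ℝ | 1 ≤ |x| ∧ |x| ≤ 1 + δ}.indicator (fun _ => 4) x) ∂gaussianReal 0 1 := by
        refine integral_mono ((hC δ hδ hδ1).integrable _)
          (hint.add (integrable_indicator_band _ _ _)) fun x => ?_
        rcases lt_or_ge |x| 1 with h | h
        · simp [truncSq_of_abs_le_one hδ h.le, not_le.2 h]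
        · rcases le_or_gt |x| (1 + δ) with h2 | h2
          · have h3 : x ^ 2 ≤ 4 := by
              rw [← sq_abs]; nlinarith [abs_nonneg x]
            simp [h, h2, (truncSq_le_sq δ x).trans h3]
          · simp [h, truncSq_eq_zero hδ h2.le, not_le.2 h2]
    _ = 1 - succQ + 4 * (gaussianReal 0 1).real {x : ℝ | 1 ≤ |x| ∧ |x| ≤ 1 + δ} := by
        rw [integral_add hint (integrable_indicator_band _ _ _),
          integral_sub (integrable_pow_gaussianReal 2 1) (integrable_gaussian_tail_pow 2),
          integral_sq_gaussianReal, integral_gaussian_tail_sq,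
          integral_indicator_const _ (measurableSet_band _ _)]
        simp [mul_comm]
    _ ≤ 1 - succQ + 8 * δ := by linarith

/-- The edge 1 - 2δ leaves room for two errors of size δ caused by resampling. The excess over the
tail indicator lives on a band of width 3δ. -/
lemma integral_one_sub_plateau_le {δ : ℝ} (hδ : 0 < δ) (hδ1 : δ ≤ 1) :
    ∫ x, (1 - plateau (1 - 2 * δ) δ x) ∂gaussianReal 0 1 ≤ succR + 6 * δ := by
  classical
  obtain ⟨C, -, hC⟩ := exists_smoothBound_plateau
  have hb := gaussianReal_band_le (a := 1 - 3 * δ) (b := 1) (by linarith)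
  have hint : Integrable (fun x : ℝ => if 1 ≤ |x| then (1 : ℝ) else 0) (gaussianReal 0 1) := by
    simpa using integrable_gaussian_tail_pow 0
  calc ∫ x, (1 - plateau (1 - 2 * δ) δ x) ∂gaussianReal 0 1
      ≤ ∫ x, ((if 1 ≤ |x| then 1 else 0) +
          {x : ℝ | 1 - 3 * δ ≤ |x| ∧ |x| ≤ 1}.indicator (fun _ => 1) x) ∂gaussianReal 0 1 := by
        refine integral_mono ((integrable_const _).sub ((hC _ δ hδ hδ1).integrable _))
          (hint.add (integrable_indicator_band _ _ _)) fun x => ?_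
        have hn := plateau_nonneg (1 - 2 * δ) δ x
        have hi : 0 ≤ {x : ℝ | 1 - 3 * δ ≤ |x| ∧ |x| ≤ 1}.indicator (fun _ => (1 : ℝ)) x :=
          Set.indicator_nonneg (fun _ _ => zero_le_one) x
        rcases le_or_gt 1 |x| with h | h
        · simp only [h, if_true]; linarith
        · rcases le_or_gt |x| (1 - 3 * δ) with h2 | h2
          · rw [plateau_eq_one hδ (by linarith)]
            simp only [not_le.2 h, if_false]; linarith
          · rw [Set.indicator_of_mem (by exact ⟨h2.le, h.le⟩)]
            simp only [not_le.2 h, if_false]; linarith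
    _ = succR + (gaussianReal 0 1).real {x : ℝ | 1 - 3 * δ ≤ |x| ∧ |x| ≤ 1} := by
        rw [integral_add hint (integrable_indicator_band _ _ _), integral_gaussian_tail_one,
          integral_indicator_const _ (measurableSet_band _ _)]
        simp
    _ ≤ succR + 6 * δ := by linarith

end GaussianIntegrals

/-! ### The promise holds for almost all oracles -/

section Promise

open MeasureTheory ProbabilityTheory Finset BigOperators

variable {n : ℕ}

lemma fourierCoeff01_eq_mul (f : Oracle n) (z : BitString n) :
    fourierCoeff01 f z = (Real.sqrt (2 ^ n))⁻¹ * ∑ x, ((f x : ℤ) : ℝ) * parityChar x z := by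
  rw [fourierCoeff01, div_eq_inv_mul]

lemma abs_expect_fourierCoeff01_sub_le {L : ℝ} {u : ℝ → ℝ} (hu : SmoothBound L u)
    (z : BitString n) :
    |𝔼 f : Oracle n, u (fourierCoeff01 f z) - ∫ x, u x ∂gaussianReal 0 1| ≤
      L * (1 + gaussianThirdMoment) * (Real.sqrt (2 ^ n))⁻¹ := by
  simp only [fourierCoeff01_eq_mul]
  refine abs_expect_signSum_sub_integral_le hu (fun x => parityChar_eq_or x z) (by positivity) ?_
  rw [inv_pow, Real.sq_sqrt (by positivity), card_bitString]
  exact mul_inv_cancel₀ (by positivity)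

lemma fourierCoeff01_flipAt (f : Oracle n) (x z : BitString n) :
    fourierCoeff01 (flipAt x f) z =
      fourierCoeff01 f z + -2 * ((f x : ℤ) : ℝ) * parityChar x z * (Real.sqrt (2 ^ n))⁻¹ := by
  have h : ∑ y, ((flipAt x f y : ℤ) : ℝ) * parityChar y z =
      ∑ y, ((f y : ℤ) : ℝ) * parityChar y z + -2 * ((f x : ℤ) : ℝ) * parityChar x z := by
    rw [← add_sum_erase _ _ (mem_univ x),
      ← add_sum_erase univ (fun y => ((f y : ℤ) : ℝ) * parityChar y z) (mem_univ x),
      sum_congr rfl fun y hy => by rw [flipAt_of_ne (ne_of_mem_erase hy)]]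
    simp only [flipAt_same, Units.val_neg, Int.cast_neg]
    ring
  rw [fourierCoeff01_eq_mul, fourierCoeff01_eq_mul, h]
  ring

/-- The average of `u` over the Fourier coefficients of `f`. -/
noncomputable def coeffAvg (u : ℝ → ℝ) (f : Oracle n) : ℝ :=
  (∑ z, u (fourierCoeff01 f z)) / 2 ^ n

/-- A flip moves every coefficient by ±2/√N. The linear term is kept as a character sum so that
Parseval can sum its square over `x`; bounding it termwise would lose a factor N. -/
lemma sq_sub_coeffAvg_flipAt_le {u u₁ u₂ : ℝ → ℝ} (h1 : ∀ x, HasDerivAt u (u₁ x) x)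
    (h2 : ∀ x, HasDerivAt u₁ (u₂ x) x) {L : ℝ} (hb : ∀ x, |u₂ x| ≤ L) (f : Oracle n)
    (x : BitString n) :
    (coeffAvg u f - coeffAvg u (flipAt x f)) ^ 2 ≤
      8 / (2 ^ n) ^ 3 * (∑ z, u₁ (fourierCoeff01 f z) * parityChar z x) ^ 2 +
        32 * L ^ 2 / (2 ^ n) ^ 2 := by
  have hN : (0 : ℝ) < 2 ^ n := by positivity
  have hL : 0 ≤ L := (abs_nonneg _).trans (hb 0)
  set N : ℝ := 2 ^ n with hNdef
  set s : ℝ := (Real.sqrt N)⁻¹ with hs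
  have hs2 : s ^ 2 = N⁻¹ := by rw [hs, inv_pow, Real.sq_sqrt hN.le]
  set ε : ℝ := ((f x : ℤ) : ℝ) with hε
  have hε2 : ε ^ 2 = 1 := units_cast_sq _
  set y : BitString n → ℝ := fun z => -2 * ε * parityChar x z * s with hy
  have hy2 : ∀ z, y z ^ 2 = 4 * N⁻¹ := by
    intro z
    calc y z ^ 2 = 4 * ε ^ 2 * parityChar x z ^ 2 * s ^ 2 := by simp only [hy]; ring
      _ = _ := by rw [hε2, parityChar_sq, hs2]; ring
  set r : BitString n → ℝ := fun z =>
    u (fourierCoeff01 f z + y z) - u (fourierCoeff01 f z) - u₁ (fourierCoeff01 f z) * y z with hr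
  have hrb : ∀ z, |r z| ≤ L * (4 * N⁻¹) := by
    intro z
    rw [← hy2 z, ← sq_abs (y z)]
    exact abs_taylor_one_le h1 h2 hb _ _
  set A : ℝ := (∑ z, u₁ (fourierCoeff01 f z) * y z) / N with hA
  set R : ℝ := (∑ z, r z) / N with hR
  have hdiff : coeffAvg u (flipAt x f) - coeffAvg u f = A + R := by
    rw [coeffAvg, coeffAvg, hA, hR, ← sub_div, ← add_div, ← sum_sub_distrib, ← sum_add_distrib]
    congr 1
    refine sum_congr rfl fun z _ => ?_
    rw [fourierCoeff01_flipAt]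
    simp only [hr, hy, hε, hs]
    ring
  have hRb : |R| ≤ 4 * L / N := by
    rw [hR, abs_div, abs_of_pos hN]
    have : |∑ z, r z| ≤ N * (L * (4 * N⁻¹)) := by
      refine (abs_sum_le_sum_abs _ _).trans ((sum_le_sum fun z _ => hrb z).trans (le_of_eq ?_))
      rw [sum_const, card_univ, nsmul_eq_mul, card_bitString]
    refine (div_le_div_of_nonneg_right this hN.le).trans (le_of_eq ?_)
    field_simp
  have hR2 : R ^ 2 ≤ 16 * L ^ 2 / N ^ 2 := by
    rw [← sq_abs]
    refine (pow_le_pow_left₀ (abs_nonneg _) hRb 2).trans (le_of_eq ?_)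
    ring
  have hA2 : A ^ 2 = 4 / N ^ 3 * (∑ z, u₁ (fourierCoeff01 f z) * parityChar z x) ^ 2 := by
    have : ∑ z, u₁ (fourierCoeff01 f z) * y z =
        -2 * ε * s * ∑ z, u₁ (fourierCoeff01 f z) * parityChar z x := by
      rw [mul_sum]
      refine sum_congr rfl fun z _ => ?_
      simp only [hy]
      rw [parityChar_comm z x]
      ring
    rw [hA, this]
    generalize ∑ z, u₁ (fourierCoeff01 f z) * parityChar z x = S
    calc (-2 * ε * s * S / N) ^ 2 = 4 * ε ^ 2 * s ^ 2 * S ^ 2 / N ^ 2 := by ring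
      _ = _ := by rw [hε2, hs2]; field_simp
  rw [← neg_sq, neg_sub, hdiff]
  have h3 : (A + R) ^ 2 ≤ 2 * A ^ 2 + 2 * R ^ 2 := by nlinarith [sq_nonneg (A - R)]
  rw [hA2] at h3
  refine h3.trans ?_
  have e : 32 * L ^ 2 / N ^ 2 = 2 * (16 * L ^ 2 / N ^ 2) := by ring
  have e' : 8 / N ^ 3 = 2 * (4 / N ^ 3) := by ring
  rw [e, e', mul_assoc]
  linarith

/-- Averages of a smooth function over the Fourier coefficients are concentrated. -/
lemma variance_coeffAvg_le {L : ℝ} {u : ℝ → ℝ} (hu : SmoothBound L u) :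
    𝔼 f : Oracle n, (coeffAvg u f) ^ 2 - (𝔼 f : Oracle n, coeffAvg u f) ^ 2 ≤
      10 * L ^ 2 / 2 ^ n := by
  obtain ⟨u₁, u₂, u₃, h1, h2, -, hb⟩ := hu
  have hN : (0 : ℝ) < 2 ^ n := by positivity
  have hp := poincare (fun f : Oracle n => coeffAvg u f)
  have hsum : ∀ f : Oracle n, ∑ x, (coeffAvg u f - coeffAvg u (flipAt x f)) ^ 2 ≤
      40 * L ^ 2 / 2 ^ n := by
    intro f
    refine (sum_le_sum fun x _ =>
      sq_sub_coeffAvg_flipAt_le h1 h2 (fun x => (hb x).2.2.1) f x).trans ?_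
    -- Parseval gives 8L²/N for the linear part, the remainder gives 32L²/N.
    rw [sum_add_distrib, ← mul_sum, sum_sq_sum_mul_parityChar, sum_const, card_univ,
      nsmul_eq_mul, card_bitString]
    have : ∑ z, u₁ (fourierCoeff01 f z) ^ 2 ≤ 2 ^ n * L ^ 2 := by
      refine (sum_le_sum fun z _ => ?_).trans (le_of_eq ?_) (b := ∑ z : BitString n, L ^ 2)
      · rw [← sq_abs]
        exact pow_le_pow_left₀ (abs_nonneg _) (hb _).2.1 2
      · rw [sum_const, card_univ, nsmul_eq_mul, card_bitString]
    calc 8 / ((2 : ℝ) ^ n) ^ 3 * (2 ^ n * ∑ z, u₁ (fourierCoeff01 f z) ^ 2) +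
          2 ^ n * (32 * L ^ 2 / (2 ^ n) ^ 2)
        ≤ 8 / ((2 : ℝ) ^ n) ^ 3 * (2 ^ n * (2 ^ n * L ^ 2)) +
          2 ^ n * (32 * L ^ 2 / (2 ^ n) ^ 2) := by gcongr
      _ = 40 * L ^ 2 / 2 ^ n := by field_simp; ring
  refine hp.trans ?_
  rw [← expect_sum_comm]
  have : 𝔼 f : Oracle n, ∑ x, (coeffAvg u f - coeffAvg u (flipAt x f)) ^ 2 ≤
      40 * L ^ 2 / 2 ^ n :=
    (expect_le_expect fun f _ => hsum f).trans (le_of_eq (Fintype.expect_const _))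
  calc _ ≤ (40 * L ^ 2 / 2 ^ n) / 4 := by gcongr
    _ = _ := by ring

open scoped Classical in
/-- Chebyshev's inequality for uniform averages. -/
lemma expect_ite_le_of_variance {α : Type*} [Fintype α] [Nonempty α] (F : α → ℝ) {m t : ℝ}
    (hm : 𝔼 a, F a ≤ m) (ht : 0 < t) (P : α → Prop) (hP : ∀ a, P a → m + t ≤ F a) :
    𝔼 a, (if P a then (1 : ℝ) else 0) ≤ (𝔼 a, F a ^ 2 - (𝔼 a, F a) ^ 2) / t ^ 2 := by
  set μ := 𝔼 a, F a with hμ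
  have hvar : 𝔼 a, (F a - μ) ^ 2 = 𝔼 a, F a ^ 2 - μ ^ 2 := by
    have : ∀ a, (F a - μ) ^ 2 = F a ^ 2 - 2 * μ * F a + μ ^ 2 := fun a => by ring
    simp only [this]
    rw [expect_add_distrib, expect_sub_distrib, ← mul_expect, ← hμ, Fintype.expect_const]
    ring
  rw [← hvar, expect_div]
  refine expect_le_expect fun a _ => ?_
  split_ifs with h
  · rw [one_le_div (by positivity)]
    exact pow_le_pow_left₀ ht.le (by linarith [hP a h]) 2
  · positivity

/-- The total weight is 1 and the truncation dominates the light part, so only a bounded smooth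
statistic has to be controlled. -/
lemma one_sub_coeffAvg_le_adv {δ : ℝ} (hδ : 0 < δ) (f : Oracle n) :
    1 - coeffAvg (truncSq δ) f ≤ adv f := by
  classical
  have hN : (0 : ℝ) < 2 ^ n := by positivity
  rw [coeffAvg, adv, sub_le_iff_le_add, ← add_div, one_le_div hN, ← sum_fourierCoeff01_sq f,
    sum_filter, ← sum_add_distrib]
  refine sum_le_sum fun z _ => ?_
  split_ifs with h
  · linarith [truncSq_nonneg δ (fourierCoeff01 f z)]
  · rw [truncSq_of_abs_le_one hδ (not_le.1 h).le, zero_add]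

lemma tendsto_sqrt_two_pow_inv_mul (k : ℕ) :
    Tendsto (fun n : ℕ => (n : ℝ) ^ k * (Real.sqrt (2 ^ n))⁻¹) atTop (nhds 0) := by
  have h := tendsto_pow_const_div_const_pow_of_one_lt k (r := Real.sqrt 2)
    (by rw [Real.lt_sqrt] <;> norm_num)
  refine h.congr fun n => ?_
  have e : Real.sqrt (2 ^ n) = Real.sqrt 2 ^ n := by
    rw [← Real.sqrt_sq (pow_nonneg (Real.sqrt_nonneg 2) n), ← pow_mul, mul_comm n 2, pow_mul,
      Real.sq_sqrt (by norm_num)]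
  rw [div_eq_mul_inv, e]

open scoped Classical in
/-- All but a vanishing fraction of the oracles satisfy the promise. -/
lemma eventually_expect_not_promise_le {η : ℝ} (hη : 0 < η) :
    ∀ᶠ n : ℕ in atTop, 𝔼 f : Oracle n, (if FishingPromise f then (0 : ℝ) else 1) ≤ η := by
  obtain ⟨C, hC0, hC⟩ := exists_smoothBound_truncSq
  set D : ℝ := C * 32 ^ 6 with hD
  have hD0 : 0 ≤ D := by positivity
  have t1 : Tendsto (fun n : ℕ => D * (1 + gaussianThirdMoment) *
      ((n : ℝ) ^ 7 * (Real.sqrt (2 ^ n))⁻¹)) atTop (nhds 0) := by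
    simpa using (tendsto_sqrt_two_pow_inv_mul 7).const_mul (D * (1 + gaussianThirdMoment))
  have t2 : Tendsto (fun n : ℕ => 40 * D ^ 2 * ((n : ℝ) ^ 14 / 2 ^ n)) atTop (nhds 0) := by
    simpa using (tendsto_pow_const_div_const_pow_of_one_lt 14
      (by norm_num : (1 : ℝ) < 2)).const_mul (40 * D ^ 2)
  filter_upwards [eventually_ge_atTop 1, t1.eventually_le_const (by norm_num : (0 : ℝ) < 1 / 4),
    t2.eventually_le_const hη] with n hn h1 h2
  have hn0 : (0 : ℝ) < n := by exact_mod_cast hn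
  have hn1 : (1 : ℝ) ≤ n := by exact_mod_cast hn
  -- Of the slack 1/n, the band error 8δ takes 1/(4n), the CLT error 1/(4n), and the Chebyshev
  -- deviation 1/(2n).
  set δ : ℝ := 1 / (32 * n) with hδdef
  have hδ : 0 < δ := by positivity
  have hδ1 : δ ≤ 1 := by rw [hδdef, div_le_one (by positivity)]; linarith
  have hL : C / δ ^ 6 = D * n ^ 6 := by rw [hδdef, hD]; field_simp
  have hu := hC δ hδ hδ1
  rw [hL] at hu
  have hmean : 𝔼 f : Oracle n, coeffAvg (truncSq δ) f ≤ 1 - succQ + 1 / (2 * n) := by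
    have hz : ∀ z : BitString n, 𝔼 f : Oracle n, truncSq δ (fourierCoeff01 f z) ≤
        1 - succQ + 1 / (2 * n) := by
      intro z
      have a := (abs_le.1 (abs_expect_fourierCoeff01_sub_le hu z)).2
      have b := integral_truncSq_le hδ hδ1
      have c : D * n ^ 6 * (1 + gaussianThirdMoment) * (Real.sqrt (2 ^ n))⁻¹ ≤ 1 / (4 * n) := by
        rw [le_div_iff₀ (by positivity)]
        linarith
      have d : 8 * δ = 1 / (4 * n) := by rw [hδdef]; field_simp; norm_num
      have e : 1 / (2 * (n : ℝ)) = 1 / (4 * n) + 1 / (4 * n) := by field_simp; norm_num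
      linarith
    simp only [coeffAvg]
    rw [← expect_div, expect_sum_comm, div_le_iff₀ (by positivity)]
    refine (sum_le_sum fun z _ => hz z).trans (le_of_eq ?_)
    rw [sum_const, card_univ, nsmul_eq_mul, card_bitString, mul_comm]
  have hcheb := expect_ite_le_of_variance (fun f : Oracle n => coeffAvg (truncSq δ) f)
    hmean (t := 1 / (2 * n)) (by positivity) (fun f => ¬ FishingPromise f) (fun f hf => by
      have a := one_sub_coeffAvg_le_adv hδ f
      have b : adv f < succQ - 1 / n := not_le.1 hf
      have e : 1 / (n : ℝ) = 1 / (2 * n) + 1 / (2 * n) := by field_simp; norm_num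
      linarith)
  refine (le_of_eq (expect_congr rfl fun f _ => ?_)).trans (hcheb.trans (le_trans ?_ h2))
  · by_cases h : FishingPromise f <;> simp [h]
  calc _ ≤ (10 * (D * n ^ 6) ^ 2 / 2 ^ n) / (1 / (2 * n)) ^ 2 := by
        gcongr
        exact variance_coeffAvg_le hu
    _ = 40 * D ^ 2 * ((n : ℝ) ^ 14 / 2 ^ n) := by field_simp; ring

end Promise

/-! ### Query trees: resampling and adaptive Chernoff bound -/

section Trees

open Finset BigOperators

variable {n : ℕ}

namespace QueryTree

/-- The set of points queried when the algorithm is run on the oracle `f`. -/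
def queried (f : Oracle n) : QueryTree n → Finset (BitString n)
  | output _ => ∅
  | query x next => insert x (queried f (next (f x)))

lemma card_queried_le (f : Oracle n) (t : QueryTree n) :
    (t.queried f).card ≤ t.numQueries f := by
  induction t with
  | output z => simp [queried, numQueries]
  | query x next ih =>
    simp only [queried, numQueries]
    exact (card_insert_le _ _).trans (Nat.add_le_add_right (ih _) 1)

lemma queried_run_congr {f g : Oracle n} (t : QueryTree n)
    (h : ∀ x ∈ t.queried f, g x = f x) : t.queried g = t.queried f ∧ t.run g = t.run f := by
  induction t with
  | output z => simp [queried, run]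
  | query x next ih =>
    simp only [queried, run] at h ⊢
    rw [h x (mem_insert_self _ _)]
    have := ih (f x) (fun y hy => h y (mem_insert_of_mem hy))
    rw [this.1, this.2]
    exact ⟨rfl, rfl⟩

/-- Exchange of the values of two oracles outside the points queried on the first one. -/
def exchange (t : QueryTree n) (p : Oracle n × Oracle n) : Oracle n × Oracle n :=
  (fun x => if x ∈ t.queried p.1 then p.1 x else p.2 x,
    fun x => if x ∈ t.queried p.1 then p.2 x else p.1 x)

lemma queried_run_exchange (t : QueryTree n) (p : Oracle n × Oracle n) :
    t.queried (t.exchange p).1 = t.queried p.1 ∧ t.run (t.exchange p).1 = t.run p.1 :=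
  queried_run_congr t fun x hx => by simp [exchange, hx]

/-- The first oracle keeps every value that `t` reads, so the second exchange uses the same queried
set and undoes the first. -/
lemma exchange_exchange (t : QueryTree n) (p : Oracle n × Oracle n) :
    t.exchange (t.exchange p) = p := by
  have h := (queried_run_exchange t p).1
  rw [exchange, h]
  refine Prod.ext (funext fun x => ?_) (funext fun x => ?_) <;>
    by_cases hx : x ∈ t.queried p.1 <;> simp [exchange, hx]

/-- Resampling the oracle at the queried points makes it independent of the output. -/
lemma expect_run_exchange (t : QueryTree n) (Φ : BitString n → Oracle n → ℝ) :
    𝔼 p : Oracle n × Oracle n, Φ (t.run p.1) (t.exchange p).2 =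
      𝔼 p : Oracle n × Oracle n, Φ (t.run p.1) p.2 :=
  Fintype.expect_equiv (Function.Involutive.toPerm t.exchange t.exchange_exchange) _ _
    fun p => by
      change _ = Φ (t.run (t.exchange p).1) (t.exchange p).2
      rw [(queried_run_exchange t p).2]

end QueryTree

/-- Since `w` ignores coordinate `x`, averaging over its flip turns the exponential into cosh l ≤
exp(l²/2). -/
lemma expect_mul_exp_flip_le {ι : Type*} [DecidableEq ι] [Fintype ι] (w : (ι → ℤˣ) → ℝ)
    (hw : ∀ f, 0 ≤ w f) (x : ι) (hx : ∀ f, w (flipAt x f) = w f) {a : ℝ} (ha : a = 1 ∨ a = -1)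
    (l : ℝ) :
    𝔼 f, w f * Real.exp (l * (((f x : ℤ) : ℝ) * a)) ≤ Real.exp (l ^ 2 / 2) * 𝔼 f, w f := by
  rw [expect_eq_expect_flip_avg x, mul_expect]
  refine expect_le_expect fun f _ => ?_
  have e : ∀ s : ℝ, s = 1 ∨ s = -1 → (Real.exp (l * s) + Real.exp (l * -s)) / 2 = Real.cosh l := by
    rintro s (rfl | rfl)
    · rw [Real.cosh_eq]; simp
    · rw [Real.cosh_eq]; simp [add_comm]
  have hs : ((f x : ℤ) : ℝ) * a = 1 ∨ ((f x : ℤ) : ℝ) * a = -1 := by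
    rcases Int.units_eq_one_or (f x) with h | h <;> rcases ha with h' | h' <;> simp [h, h']
  rw [hx, flipAt_same, Units.val_neg, Int.cast_neg, neg_mul, ← mul_add, mul_div_assoc, e _ hs,
    mul_comm]
  exact mul_le_mul_of_nonneg_right (Real.cosh_le_exp_half_sq l) (hw f)

lemma expect_exp_signSum_le {ι : Type*} [DecidableEq ι] [Fintype ι] {c : ι → ℝ}
    (hc : ∀ x, c x = 1 ∨ c x = -1) (l : ℝ) (s : Finset ι) :
    𝔼 f : ι → ℤˣ, Real.exp (l * ∑ x ∈ s, ((f x : ℤ) : ℝ) * c x) ≤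
      Real.exp (l ^ 2 / 2 * s.card) := by
  induction s using Finset.induction_on with
  | empty => simp
  | insert y s hy ih =>
    have e := expect_mul_exp_flip_le
      (fun f : ι → ℤˣ => Real.exp (l * ∑ x ∈ s, ((f x : ℤ) : ℝ) * c x))
      (fun f => (Real.exp_pos _).le) y (fun f => by
        rw [sum_congr rfl fun x hx => by rw [flipAt_of_ne (ne_of_mem_of_not_mem hx hy)]])
      (hc y) l
    simp only [← Real.exp_add, ← mul_add] at e
    simp only [sum_insert hy, card_insert_of_notMem hy]
    rw [expect_congr rfl fun f _ => by rw [add_comm (_ * c y)]]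
    refine e.trans ((mul_le_mul_of_nonneg_left ih (Real.exp_pos _).le).trans (le_of_eq ?_))
    rw [← Real.exp_add]
    push_cast; ring_nf

/-- The exponential moments of an adaptively queried signed sum, conditionally on the values at
the points of `P`. -/
lemma QueryTree.expect_mul_exp_queried_sdiff_le {c : BitString n → ℝ}
    (hc : ∀ x, c x = 1 ∨ c x = -1) (l : ℝ) (t : QueryTree n) :
    ∀ (P : Finset (BitString n)) (w : Oracle n → ℝ) (T : ℕ), (∀ f, 0 ≤ w f) →
      (∀ x ∉ P, ∀ f, w (flipAt x f) = w f) → (∀ f, w f ≠ 0 → t.numQueries f ≤ T) →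
      𝔼 f, w f * Real.exp (l * ∑ x ∈ t.queried f \ P, ((f x : ℤ) : ℝ) * c x) ≤
        Real.exp (l ^ 2 / 2 * T) * 𝔼 f, w f := by
  induction t with
  | output z =>
    intro P w T hw _ _
    simp only [queried, empty_sdiff, sum_empty, mul_zero, Real.exp_zero, mul_one]
    exact le_mul_of_one_le_left (expect_nonneg fun f _ => hw f)
      (Real.one_le_exp (by positivity))
  | query x next ih =>
    intro P w T hw hP hT
    -- A query node uses at least one query, so for `T = 0` the weight vanishes identically.
    rcases T with _ | T
    · have hz : ∀ f, w f = 0 := by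
        intro f
        by_contra h
        have := hT f h
        simp [numQueries] at this
      simp [hz]
    -- Only a first query of `x` contributes a factor; `P` records the points already read.
    set E : Oracle n → ℝ := fun f =>
      if x ∈ P then 1 else Real.exp (l * (((f x : ℤ) : ℝ) * c x)) with hE
    have hEpos : ∀ f, 0 ≤ E f := fun f => by
      simp only [hE]; split_ifs <;> positivity
    -- Restricting the weight to one answer conditions on it; the restricted weight depends only on
    -- `insert x P`, as the induction hypothesis demands.
    set v : ℤˣ → Oracle n → ℝ := fun b f => if f x = b then w f * E f else 0 with hv
    have hsplit : ∀ f, w f * E f = v 1 f + v (-1) f := by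
      intro f
      rcases Int.units_eq_one_or (f x) with h | h <;> simp [hv, h]
    have hmain : ∀ f, w f * Real.exp (l * ∑ y ∈ (query x next).queried f \ P,
          ((f y : ℤ) : ℝ) * c y) =
        v 1 f * Real.exp (l * ∑ y ∈ (next 1).queried f \ insert x P, ((f y : ℤ) : ℝ) * c y) +
        v (-1) f * Real.exp (l * ∑ y ∈ (next (-1)).queried f \ insert x P,
          ((f y : ℤ) : ℝ) * c y) := by
      intro f
      have h1 : Real.exp (l * ∑ y ∈ (query x next).queried f \ P, ((f y : ℤ) : ℝ) * c y) =
          E f * Real.exp (l * ∑ y ∈ (next (f x)).queried f \ insert x P,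
            ((f y : ℤ) : ℝ) * c y) := by
        simp only [queried, hE]
        split_ifs with hx
        · rw [insert_sdiff_of_mem _ hx, insert_eq_of_mem hx, one_mul]
        · have hs : insert x ((next (f x)).queried f) \ P =
              insert x ((next (f x)).queried f \ insert x P) := by
            ext y; by_cases hy : y = x <;> simp [hy, hx]
          rw [hs, sum_insert (by simp), mul_add, Real.exp_add]
      rw [h1, ← mul_assoc]
      rcases Int.units_eq_one_or (f x) with h | h <;> simp [hv, h]
    have hstep : ∀ b, 𝔼 f, v b f * Real.exp (l * ∑ y ∈ (next b).queried f \ insert x P,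
        ((f y : ℤ) : ℝ) * c y) ≤ Real.exp (l ^ 2 / 2 * T) * 𝔼 f, v b f := by
      intro b
      refine ih b (insert x P) (v b) T (fun f => ?_) (fun y hy f => ?_) (fun f hf => ?_)
      · simp only [hv]
        split_ifs
        · exact mul_nonneg (hw f) (hEpos f)
        · exact le_rfl
      · have hyx : x ≠ y := fun h => hy (h ▸ mem_insert_self _ _)
        have hyP : y ∉ P := fun h => hy (mem_insert_of_mem h)
        simp only [hv, hE, flipAt_of_ne hyx, hP y hyP]
      · simp only [hv, ne_eq, ite_eq_right_iff, Classical.not_imp, mul_eq_zero, not_or] at hf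
        have := hT f hf.2.1
        simp only [numQueries, hf.1] at this
        omega
    have hE' : 𝔼 f, w f * E f ≤ Real.exp (l ^ 2 / 2) * 𝔼 f, w f := by
      by_cases hx : x ∈ P
      · simp only [hE, hx, if_true, mul_one]
        exact le_mul_of_one_le_left (expect_nonneg fun f _ => hw f)
          (Real.one_le_exp (by positivity))
      · simp only [hE, hx, if_false]
        exact expect_mul_exp_flip_le w hw x (hP x hx) (hc x) l
    rw [expect_congr rfl fun f _ => hmain f, expect_add_distrib]
    refine (add_le_add (hstep 1) (hstep (-1))).trans ?_
    rw [← mul_add, ← expect_add_distrib, ← expect_congr rfl fun f _ => hsplit f]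
    refine (mul_le_mul_of_nonneg_left hE' (Real.exp_pos _).le).trans (le_of_eq ?_)
    rw [← mul_assoc, ← Real.exp_add]
    push_cast; ring_nf

lemma QueryTree.expect_exp_queried_le {c : BitString n → ℝ} (hc : ∀ x, c x = 1 ∨ c x = -1)
    (l : ℝ) (t : QueryTree n) {T : ℕ} (hT : ∀ f, t.numQueries f ≤ T) :
    𝔼 f : Oracle n, Real.exp (l * ∑ x ∈ t.queried f, ((f x : ℤ) : ℝ) * c x) ≤
      Real.exp (l ^ 2 / 2 * T) := by
  simpa using t.expect_mul_exp_queried_sdiff_le hc l ∅ (fun _ => 1) T (fun _ => zero_le_one)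
    (fun _ _ _ => rfl) (fun f _ => hT f)

open scoped Classical in
/-- Chernoff's bound from a bound on the exponential moments. -/
lemma expect_ite_le_of_exp {α : Type*} [Fintype α] [Nonempty α] (S : α → ℝ) {a l K : ℝ}
    (hl : 0 ≤ l) (h1 : 𝔼 p, Real.exp (l * S p) ≤ K) (h2 : 𝔼 p, Real.exp (-l * S p) ≤ K) :
    𝔼 p, (if a ≤ |S p| then (1 : ℝ) else 0) ≤ 2 * (Real.exp (-(l * a)) * K) := by
  have h : ∀ p, (if a ≤ |S p| then (1 : ℝ) else 0) ≤
      Real.exp (-(l * a)) * (Real.exp (l * S p) + Real.exp (-l * S p)) := by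
    intro p
    rw [mul_add, ← Real.exp_add, ← Real.exp_add]
    split_ifs with h
    · rcases le_abs.1 h with h | h
      · have : 1 ≤ Real.exp (-(l * a) + l * S p) := Real.one_le_exp (by nlinarith)
        linarith [Real.exp_pos (-(l * a) + -l * S p)]
      · have : 1 ≤ Real.exp (-(l * a) + -l * S p) := Real.one_le_exp (by nlinarith)
        linarith [Real.exp_pos (-(l * a) + l * S p)]
    · positivity
  refine (expect_le_expect fun p _ => h p).trans ?_
  rw [← mul_expect, expect_add_distrib]
  have := mul_le_mul_of_nonneg_left (add_le_add h1 h2) (Real.exp_pos (-(l * a))).le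
  linarith

end Trees

/-! ### Success probability of one tree on a random oracle -/

section Fishing

open MeasureTheory ProbabilityTheory Finset BigOperators

variable {n : ℕ}

lemma expect_prod {α β : Type*} [Fintype α] [Fintype β] (F : α → β → ℝ) :
    𝔼 p : α × β, F p.1 p.2 = 𝔼 a, 𝔼 b, F a b := by
  rw [← univ_product_univ, expect_product]

lemma expect_prod_fst {α β : Type*} [Fintype α] [Fintype β] [Nonempty β] (F : α → ℝ) :
    𝔼 p : α × β, F p.1 = 𝔼 a, F a := by
  rw [expect_prod (fun a _ => F a)]
  simp

/-- The part of the Fourier coefficient of `f` at `z` that comes from the points queried by `t`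
on `f`, and the corresponding sum for a second oracle `g`. -/
noncomputable def QueryTree.queriedSum (t : QueryTree n) (f g : Oracle n) (z : BitString n) : ℝ :=
  ∑ x ∈ t.queried f, ((g x : ℤ) : ℝ) * parityChar x z

lemma QueryTree.fourierCoeff01_exchange (t : QueryTree n) (f g : Oracle n) (z : BitString n) :
    fourierCoeff01 (t.exchange (f, g)).2 z = fourierCoeff01 f z +
      (Real.sqrt (2 ^ n))⁻¹ * t.queriedSum f g z - (Real.sqrt (2 ^ n))⁻¹ * t.queriedSum f f z := by
  have h : ∑ x, (((t.exchange (f, g)).2 x : ℤ) : ℝ) * parityChar x z =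
      ∑ x, ((f x : ℤ) : ℝ) * parityChar x z + t.queriedSum f g z - t.queriedSum f f z := by
    rw [QueryTree.queriedSum, QueryTree.queriedSum, ← univ_inter (t.queried f), ← sum_ite_mem,
      ← sum_ite_mem, ← sum_add_distrib, ← sum_sub_distrib]
    refine sum_congr rfl fun x _ => ?_
    by_cases hx : x ∈ t.queried f <;> simp [exchange, hx]
  rw [fourierCoeff01_eq_mul, fourierCoeff01_eq_mul, h]
  ring

open scoped Classical in
-- If both queried sums are below δ√N, a heavy output keeps a coefficient of size at least 1 - 2δ
-- after resampling, where the plateau vanishes. The output depends on the queried values of `f`,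
-- hence the sum over all `z` for `f`; it is independent of `g`, so one term suffices there.
lemma QueryTree.ite_isHeavy_le (t : QueryTree n) {δ : ℝ} (hδ : 0 < δ) (f g : Oracle n) :
    (if IsHeavy f (t.run f) then (1 : ℝ) else 0) ≤
      ∑ z, (if δ * Real.sqrt (2 ^ n) ≤ |t.queriedSum f f z| then (1 : ℝ) else 0) +
      (if δ * Real.sqrt (2 ^ n) ≤ |t.queriedSum f g (t.run f)| then (1 : ℝ) else 0) +
      (1 - plateau (1 - 2 * δ) δ (fourierCoeff01 (t.exchange (f, g)).2 (t.run f))) := by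
  have n1 : 0 ≤ ∑ z, (if δ * Real.sqrt (2 ^ n) ≤ |t.queriedSum f f z| then (1 : ℝ) else 0) :=
    sum_nonneg fun z _ => by split_ifs <;> norm_num
  have n2 : (0 : ℝ) ≤ if δ * Real.sqrt (2 ^ n) ≤ |t.queriedSum f g (t.run f)| then 1 else 0 := by
    split_ifs <;> norm_num
  have n3 := plateau_le_one (1 - 2 * δ) δ (fourierCoeff01 (t.exchange (f, g)).2 (t.run f))
  by_cases hH : IsHeavy f (t.run f)
  swap
  · rw [if_neg hH]; linarith
  rw [if_pos hH]
  by_cases h1 : δ * Real.sqrt (2 ^ n) ≤ |t.queriedSum f f (t.run f)|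
  · have : (1 : ℝ) ≤
        ∑ z, (if δ * Real.sqrt (2 ^ n) ≤ |t.queriedSum f f z| then (1 : ℝ) else 0) := by
      refine le_trans (by rw [if_pos h1]) (single_le_sum
        (f := fun z => if δ * Real.sqrt (2 ^ n) ≤ |t.queriedSum f f z| then (1 : ℝ) else 0)
        (fun z _ => by split_ifs <;> norm_num) (mem_univ (t.run f)))
    linarith
  by_cases h2 : δ * Real.sqrt (2 ^ n) ≤ |t.queriedSum f g (t.run f)|
  · rw [if_pos h2]; linarith
  have hs : 0 < Real.sqrt (2 ^ n) := Real.sqrt_pos.2 (by positivity)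
  have small : ∀ S : ℝ, ¬ δ * Real.sqrt (2 ^ n) ≤ |S| → |(Real.sqrt (2 ^ n))⁻¹ * S| ≤ δ := by
    intro S hS
    rw [abs_mul, abs_of_pos (inv_pos.2 hs), ← div_eq_inv_mul, div_le_iff₀ hs]
    exact (not_le.1 hS).le
  rw [plateau_eq_zero (a := 1 - 2 * δ) hδ]
  · linarith
  · rw [QueryTree.fourierCoeff01_exchange]
    have a := small _ h1
    have b := small _ h2
    generalize (Real.sqrt (2 ^ n))⁻¹ * t.queriedSum f f (t.run f) = A at a ⊢
    generalize (Real.sqrt (2 ^ n))⁻¹ * t.queriedSum f g (t.run f) = B at b ⊢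
    have c : 1 ≤ |fourierCoeff01 f (t.run f)| := hH
    generalize fourierCoeff01 f (t.run f) = F at c ⊢
    have e : F = (F + B - A) + A - B := by ring
    have d : |F| ≤ |F + B - A| + |A| + |B| := by
      conv_lhs => rw [e]
      exact (abs_sub _ _).trans (add_le_add_left (abs_add_le _ _) _)
    linarith

open scoped Classical in
lemma QueryTree.expect_isHeavy_le (t : QueryTree n) {T : ℕ} (hT : ∀ f, t.numQueries f ≤ T)
    {δ L l : ℝ} (hδ : 0 < δ) (hδ1 : δ ≤ 1) (hl : 0 ≤ l)
    (hL : SmoothBound L (plateau (1 - 2 * δ) δ)) :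
    𝔼 f : Oracle n, (if IsHeavy f (t.run f) then (1 : ℝ) else 0) ≤
      2 * (2 ^ n + 1) *
        (Real.exp (-(l * (δ * Real.sqrt (2 ^ n)))) * Real.exp (l ^ 2 / 2 * T)) +
      (succR + 6 * δ + L * (1 + gaussianThirdMoment) * (Real.sqrt (2 ^ n))⁻¹) := by
  set a : ℝ := δ * Real.sqrt (2 ^ n) with ha
  have h1 : ∀ z : BitString n, 𝔼 p : Oracle n × Oracle n,
      (if a ≤ |t.queriedSum p.1 p.1 z| then (1 : ℝ) else 0) ≤
        2 * (Real.exp (-(l * a)) * Real.exp (l ^ 2 / 2 * T)) := by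
    intro z
    rw [expect_prod_fst (fun f : Oracle n => if a ≤ |t.queriedSum f f z| then (1 : ℝ) else 0)]
    refine expect_ite_le_of_exp _ hl ?_ ?_
    · exact t.expect_exp_queried_le (fun x => parityChar_eq_or x z) l hT
    · rw [← neg_sq]
      exact t.expect_exp_queried_le (fun x => parityChar_eq_or x z) (-l) hT
  have h2 : 𝔼 p : Oracle n × Oracle n,
      (if a ≤ |t.queriedSum p.1 p.2 (t.run p.1)| then (1 : ℝ) else 0) ≤
        2 * (Real.exp (-(l * a)) * Real.exp (l ^ 2 / 2 * T)) := by
    rw [expect_prod (fun f g : Oracle n =>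
      if a ≤ |t.queriedSum f g (t.run f)| then (1 : ℝ) else 0)]
    refine (expect_le_expect fun f _ => ?_).trans (le_of_eq (Fintype.expect_const _))
    have hcard : ((t.queried f).card : ℝ) ≤ T := by
      exact_mod_cast (t.card_queried_le f).trans (hT f)
    have hexp : ∀ l : ℝ, 𝔼 g : Oracle n, Real.exp (l * t.queriedSum f g (t.run f)) ≤
        Real.exp (l ^ 2 / 2 * T) := fun l =>
      (expect_exp_signSum_le (fun x => parityChar_eq_or x (t.run f)) l (t.queried f)).trans
        (Real.exp_le_exp.2 (mul_le_mul_of_nonneg_left hcard (by positivity)))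
    refine expect_ite_le_of_exp _ hl (hexp l) ?_
    rw [← neg_sq]
    exact hexp (-l)
  have h3 : 𝔼 p : Oracle n × Oracle n,
      (1 - plateau (1 - 2 * δ) δ (fourierCoeff01 (t.exchange p).2 (t.run p.1))) ≤
        succR + 6 * δ + L * (1 + gaussianThirdMoment) * (Real.sqrt (2 ^ n))⁻¹ := by
    rw [t.expect_run_exchange (fun z f => 1 - plateau (1 - 2 * δ) δ (fourierCoeff01 f z)),
      expect_prod (fun f g => 1 - plateau (1 - 2 * δ) δ (fourierCoeff01 g (t.run f)))]
    refine (expect_le_expect fun f _ => ?_).trans (le_of_eq (Fintype.expect_const _))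
    rw [expect_sub_distrib, Fintype.expect_const]
    have e1 := (abs_le.1 (abs_expect_fourierCoeff01_sub_le hL (t.run f))).1
    have e2 := integral_one_sub_plateau_le hδ hδ1
    rw [integral_sub (integrable_const _) (hL.integrable _)] at e2
    simp only [integral_const, probReal_univ, smul_eq_mul, mul_one] at e2
    linarith
  rw [← expect_prod_fst (β := Oracle n)]
  refine (expect_le_expect fun p _ => t.ite_isHeavy_le hδ p.1 p.2).trans ?_
  rw [expect_add_distrib, expect_add_distrib, expect_sum_comm]
  have h1' := sum_le_sum fun z (_ : z ∈ (univ : Finset (BitString n))) => h1 z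
  rw [sum_const, card_univ, nsmul_eq_mul, card_bitString] at h1'
  refine (add_le_add (add_le_add h1' h2) h3).trans (le_of_eq ?_)
  ring

/-- The choice l = 4n/(δ√N) makes the linear term -4n, and the bound on `T` makes the quadratic one
at most 2n. The resulting exp(-2n) beats the union bound over 2^n strings; this is the source of the
logarithm in N/log N. -/
lemma chernoff_exponent_le {δ : ℝ} (hδ : 0 < δ) {n : ℕ} (hn : 0 < n) {T : ℝ}
    (hT : T ≤ δ ^ 2 / 4 * (2 ^ n / n)) :
    -(4 * n / (δ * Real.sqrt (2 ^ n)) * (δ * Real.sqrt (2 ^ n))) +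
      (4 * n / (δ * Real.sqrt (2 ^ n))) ^ 2 / 2 * T ≤ -(2 * n) := by
  have hn0 : (0 : ℝ) < n := by exact_mod_cast hn
  have hs : 0 < Real.sqrt (2 ^ n) := Real.sqrt_pos.2 (by positivity)
  have hN : (0 : ℝ) < 2 ^ n := by positivity
  have h1 : 4 * n / (δ * Real.sqrt (2 ^ n)) * (δ * Real.sqrt (2 ^ n)) = 4 * n := by
    field_simp
  have h2 : (4 * n / (δ * Real.sqrt (2 ^ n))) ^ 2 / 2 * T ≤ 2 * n := by
    refine (mul_le_mul_of_nonneg_left hT (by positivity)).trans (le_of_eq ?_)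
    rw [div_pow, mul_pow δ, Real.sq_sqrt hN.le]
    field_simp
    ring
  linarith

lemma tendsto_union_bound :
    Tendsto (fun n : ℕ => 2 * ((2 : ℝ) ^ n + 1) * Real.exp (-(2 * n))) atTop (nhds 0) := by
  have h : Tendsto (fun n : ℕ => 4 * ((1 : ℝ) / 2) ^ n) atTop (nhds 0) := by
    simpa using (tendsto_pow_atTop_nhds_zero_of_lt_one (by norm_num : (0 : ℝ) ≤ 1 / 2)
      (by norm_num)).const_mul 4
  refine squeeze_zero (fun n => by positivity) (fun n => ?_) h
  have e1 : (2 : ℝ) ≤ Real.exp 1 := by linarith [Real.add_one_le_exp (1 : ℝ)]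
  have e2 : Real.exp (-(2 * n)) ≤ (1 / 4) ^ n := by
    have : Real.exp (-(2 * n)) = ((Real.exp 1 ^ 2)⁻¹) ^ n := by
      rw [← Real.exp_nat_mul, ← Real.exp_neg, ← Real.exp_nat_mul]
      congr 1; push_cast; ring
    rw [this]
    refine pow_le_pow_left₀ (by positivity) ?_ n
    rw [one_div]
    exact inv_anti₀ (by norm_num) (by nlinarith)
  have e3 : (1 : ℝ) ≤ 2 ^ n := one_le_pow₀ (by norm_num)
  calc 2 * ((2 : ℝ) ^ n + 1) * Real.exp (-(2 * n)) ≤ 2 * (2 ^ n + 2 ^ n) * (1 / 4) ^ n := by gcongr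
    _ = 4 * (2 ^ n * (1 / 4) ^ n) := by ring
    _ = 4 * (1 / 2) ^ n := by rw [← mul_pow]; norm_num

open scoped Classical in
/-- A query tree with few queries finds a heavy string of a random oracle with probability at most
`succR`, up to a small error. -/
lemma exists_eventually_expect_isHeavy_le {c : ℝ} (hc : 0 < c) :
    ∃ κ : ℝ, 0 < κ ∧ ∀ᶠ n : ℕ in atTop, ∀ (t : QueryTree n) (T : ℕ),
      (∀ f, t.numQueries f ≤ T) → (T : ℝ) ≤ κ * (2 ^ n / n) →
        𝔼 f : Oracle n, (if IsHeavy f (t.run f) then (1 : ℝ) else 0) ≤ succR + c := by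
  obtain ⟨C, -, hC⟩ := exists_smoothBound_plateau
  -- The band error 6δ, the CLT error and the union bound get c/3 each.
  set δ : ℝ := min 1 (c / 18) with hδdef
  have hδ : 0 < δ := lt_min one_pos (by positivity)
  have hδ1 : δ ≤ 1 := min_le_left _ _
  have hδc : 6 * δ ≤ c / 3 := by linarith [min_le_right 1 (c / 18)]
  have hL := hC (1 - 2 * δ) δ hδ hδ1
  have t1 : Tendsto (fun n : ℕ => C / δ ^ 6 * (1 + gaussianThirdMoment) *
      (Real.sqrt (2 ^ n))⁻¹) atTop (nhds 0) := by
    simpa using (tendsto_sqrt_two_pow_inv_mul 0).const_mul (C / δ ^ 6 * (1 + gaussianThirdMoment))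
  have hc3 : 0 < c / 3 := by positivity
  refine ⟨δ ^ 2 / 4, by positivity, ?_⟩
  filter_upwards [eventually_ge_atTop 1, t1.eventually_le_const hc3,
    tendsto_union_bound.eventually_le_const hc3] with n hn h1 h2 t T hT hTn
  have key := t.expect_isHeavy_le hT hδ hδ1 (l := 4 * n / (δ * Real.sqrt (2 ^ n)))
    (by positivity) hL
  rw [← Real.exp_add] at key
  have e : 2 * ((2 : ℝ) ^ n + 1) * Real.exp (-(4 * n / (δ * Real.sqrt (2 ^ n)) *
      (δ * Real.sqrt (2 ^ n))) + (4 * n / (δ * Real.sqrt (2 ^ n))) ^ 2 / 2 * T) ≤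
      2 * ((2 : ℝ) ^ n + 1) * Real.exp (-(2 * n)) := by
    gcongr
    exact chernoff_exponent_le hδ hn hTn
  linarith

end Fishing

/-! ### Randomized algorithms and the reduction from sampling -/

section Randomized

open Finset BigOperators

variable {n : ℕ}

namespace RandQueryAlg

open scoped Classical in
lemma fishingProb_eq_tsum (A : RandQueryAlg n) (f : Oracle n) :
    A.fishingProb f = ∑' t, (A t).toReal * (if IsHeavy f (t.run f) then 1 else 0) := by
  have h : ∑ z with IsHeavy f z, A.outputDist f z =
      ∑' t, A t * (if IsHeavy f (t.run f) then 1 else 0) := by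
    simp only [outputDist, PMF.map_apply]
    rw [← Summable.tsum_finsetSum fun _ _ => ENNReal.summable]
    refine tsum_congr fun t => ?_
    rw [sum_filter]
    by_cases ht : IsHeavy f (t.run f)
    · rw [sum_eq_single (t.run f)]
      · simp [ht]
      · intro z _ hz; simp [hz]
      · simp
    · rw [if_neg ht, mul_zero]
      refine sum_eq_zero fun z _ => ?_
      split_ifs with h1 h2
      · exact absurd (h2 ▸ h1) ht
      · rfl
      · rfl
  rw [fishingProb, ← ENNReal.toReal_sum fun z _ => PMF.apply_ne_top _ _, h,
    ENNReal.tsum_toReal_eq]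
  · refine tsum_congr fun t => ?_
    rw [ENNReal.toReal_mul]
    split_ifs <;> simp
  · intro t
    split_ifs <;> simp [PMF.apply_ne_top]

lemma summable_toReal (A : RandQueryAlg n) : Summable fun t => (A t).toReal :=
  ENNReal.summable_toReal A.tsum_coe_ne_top

lemma tsum_toReal (A : RandQueryAlg n) : ∑' t, (A t).toReal = 1 := by
  rw [← ENNReal.tsum_toReal_eq fun t => PMF.apply_ne_top _ _, A.tsum_coe, ENNReal.toReal_one]

open scoped Classical in
-- The easy direction of Yao's principle: the averages over oracles and over trees are interchanged.
lemma expect_fishingProb_le (A : RandQueryAlg n) {b : ℝ}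
    (h : ∀ t ∈ A.support, 𝔼 f : Oracle n, (if IsHeavy f (t.run f) then (1 : ℝ) else 0) ≤ b) :
    𝔼 f, A.fishingProb f ≤ b := by
  have hs : ∀ f, Summable fun t => (A t).toReal * (if IsHeavy f (t.run f) then (1 : ℝ) else 0) :=
    fun f => A.summable_toReal.of_nonneg_of_le
      (fun t => mul_nonneg ENNReal.toReal_nonneg (by split_ifs <;> norm_num))
      (fun t => mul_le_of_le_one_right ENNReal.toReal_nonneg (by split_ifs <;> norm_num))
  simp only [fishingProb_eq_tsum]
  have hswap : 𝔼 f : Oracle n, ∑' t, (A t).toReal * (if IsHeavy f (t.run f) then (1 : ℝ) else 0) =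
      ∑' t, (A t).toReal * 𝔼 f : Oracle n, (if IsHeavy f (t.run f) then (1 : ℝ) else 0) := by
    rw [Fintype.expect_eq_sum_div_card, ← Summable.tsum_finsetSum fun f _ => hs f,
      ← tsum_div_const]
    refine tsum_congr fun t => ?_
    rw [Fintype.expect_eq_sum_div_card, ← mul_sum, mul_div_assoc]
  have hle : ∀ t, (A t).toReal * 𝔼 f : Oracle n, (if IsHeavy f (t.run f) then (1 : ℝ) else 0) ≤
      (A t).toReal * b := by
    intro t
    by_cases ht : t ∈ A.support
    · exact mul_le_mul_of_nonneg_left (h t ht) ENNReal.toReal_nonneg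
    · rw [PMF.mem_support_iff, not_not] at ht
      simp [ht]
  have hsum2 : Summable fun t => (A t).toReal * b := A.summable_toReal.mul_right b
  have hsum1 : Summable fun t => (A t).toReal *
      𝔼 f : Oracle n, (if IsHeavy f (t.run f) then (1 : ℝ) else 0) := by
    refine A.summable_toReal.of_nonneg_of_le
      (fun t => mul_nonneg ENNReal.toReal_nonneg
        (expect_nonneg fun f _ => by split_ifs <;> norm_num))
      (fun t => mul_le_of_le_one_right ENNReal.toReal_nonneg ?_)
    exact (expect_le_expect fun f _ => by split_ifs <;> norm_num).trans
      (le_of_eq (Fintype.expect_const 1))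
  rw [hswap]
  refine (hsum1.tsum_le_tsum hle hsum2).trans (le_of_eq ?_)
  rw [tsum_mul_right, A.tsum_toReal, one_mul]

lemma fishingProb_nonneg (A : RandQueryAlg n) (f : Oracle n) : 0 ≤ A.fishingProb f :=
  sum_nonneg fun _ _ => ENNReal.toReal_nonneg

/-- Total variation bounds the loss of mass on the heavy set. Both distributions have mass 1, so the
signed differences cancel when the pointwise bound is summed. -/
lemma adv_sub_samplingError_le (A : RandQueryAlg n) (f : Oracle n) :
    adv f - A.samplingError f ≤ A.fishingProb f := by
  classical
  set q : BitString n → ℝ := fun z => (A.outputDist f z).toReal with hq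
  set p : BitString n → ℝ := fun z => fourierWeight f z with hp
  have hqs : ∑ z, q z = 1 := by
    simp only [hq]
    rw [← ENNReal.toReal_sum fun z _ => PMF.apply_ne_top _ _,
      ← tsum_fintype (L := .unconditional _), PMF.tsum_coe, ENNReal.toReal_one]
  have hps : ∑ z, p z = 1 := by
    simp only [hp, fourierWeight]
    rw [← sum_div, sum_fourierCoeff01_sq, div_self (by positivity)]
  have hadv : adv f = ∑ z with IsHeavy f z, p z := by
    simp only [adv, hp, fourierWeight, sum_div]
  have h2 : ∀ z, (if IsHeavy f z then p z - q z else 0) ≤ (|q z - p z| - (q z - p z)) / 2 := by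
    intro z
    split_ifs
    · linarith [neg_abs_le (q z - p z)]
    · linarith [le_abs_self (q z - p z)]
  have h3 := sum_le_sum fun z (_ : z ∈ (univ : Finset (BitString n))) => h2 z
  rw [← sum_filter, sum_sub_distrib, ← hadv, ← sum_div, sum_sub_distrib, sum_sub_distrib, hqs,
    hps] at h3
  rw [fishingProb, samplingError]
  simp only [hq, hp] at h3
  linarith

end RandQueryAlg

/-- A randomized algorithm with few queries fails on some oracle that satisfies the promise. -/
lemma exists_eventually_exists_promise_fishingProb_lt {c : ℝ} (hc : 0 < c) :
    ∃ κ : ℝ, 0 < κ ∧ ∀ᶠ n : ℕ in atTop, ∀ (T : ℕ) (A : RandQueryAlg n), A.MakesAtMost T →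
      (T : ℝ) ≤ κ * (2 ^ n / n) → ∃ f : Oracle n, FishingPromise f ∧
        A.fishingProb f < succR + c := by
  classical
  obtain ⟨κ, hκ, hev⟩ := exists_eventually_expect_isHeavy_le (c := c / 2) (by positivity)
  refine ⟨κ, hκ, ?_⟩
  have hR : 0 ≤ succR := by
    rw [← integral_gaussian_tail_one]
    exact MeasureTheory.integral_nonneg fun x => by
      dsimp only; split_ifs <;> norm_num
  -- If `A` succeeded on the whole promise, its mean success would be at least `succR` + c - c/4,
  -- above the upper bound `succR` + c/2.
  set η : ℝ := c / 4 / (succR + c) with hη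
  have hη0 : 0 < η := by positivity
  filter_upwards [hev, eventually_expect_not_promise_le hη0] with n h1 h2 T A hA hT
  by_contra! hcon
  have hup := A.expect_fishingProb_le fun t ht => h1 t T (hA t ht) hT
  have hpt : ∀ f : Oracle n, (succR + c) * (1 - (if FishingPromise f then (0 : ℝ) else 1)) ≤
      A.fishingProb f := by
    intro f
    split_ifs with h
    · simpa using hcon f h
    · simpa using A.fishingProb_nonneg f
  have hlow := expect_le_expect fun f (_ : f ∈ (univ : Finset (Oracle n))) => hpt f
  rw [← mul_expect, expect_sub_distrib, Fintype.expect_const] at hlow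
  have e : (succR + c) * η = c / 4 := by rw [hη]; field_simp
  have := mul_le_mul_of_nonneg_left h2 (by positivity : 0 ≤ succR + c)
  linarith

end Randomized

theorem mainTheorem8 :
    -- Fourier Fishing, on oracles satisfying the promise
    (∀ T : ℕ → ℕ,
      (fun n => (T n : ℝ)) =o[atTop] (fun n : ℕ => (2 : ℝ) ^ n / Real.logb 2 ((2 : ℝ) ^ n)) →
      ∀ A : (n : ℕ) → RandQueryAlg n, (∀ n, (A n).MakesAtMost (T n)) →
      ∀ c : ℝ, 0 < c →
        ∀ᶠ n in atTop, ∃ f : Oracle n, FishingPromise f ∧ (A n).fishingProb f < succR + c) ∧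
    -- Fourier Sampling with large error
    (∀ ε : ℝ, ε < succQ - succR →
      ∃ c : ℝ, 0 < c ∧ ∀ᶠ n in atTop, ∀ (T : ℕ) (A : RandQueryAlg n),
        A.MakesAtMost T → A.SolvesFourierSampling ε →
          c * ((2 : ℝ) ^ n / Real.logb 2 ((2 : ℝ) ^ n)) ≤ (T : ℝ)) := by
  have hlog : ∀ n : ℕ, Real.logb 2 ((2 : ℝ) ^ n) = n := fun n => by
    rw [Real.logb_pow, Real.logb_self_eq_one (by norm_num), mul_one]
  simp only [hlog]
  constructor
  · intro T hT A hA c hc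
    obtain ⟨κ, hκ, hev⟩ := exists_eventually_exists_promise_fishingProb_lt hc
    filter_upwards [hev, hT.bound hκ] with n h1 h2
    refine h1 (T n) (A n) (hA n) ?_
    rwa [Real.norm_of_nonneg (by positivity), Real.norm_of_nonneg (by positivity)] at h2
  · intro ε hε
    -- Half of the gap is the advantage excluded for Fishing; the other half absorbs the 1/n of the
    -- promise.
    set c : ℝ := (succQ - succR - ε) / 2 with hc
    have hc0 : 0 < c := by rw [hc]; linarith
    obtain ⟨κ, hκ, hev⟩ := exists_eventually_exists_promise_fishingProb_lt hc0
    refine ⟨κ, hκ, ?_⟩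
    have hinv := tendsto_one_div_atTop_nhds_zero_nat (𝕜 := ℝ)
    filter_upwards [hev, hinv.eventually_le_const hc0] with n h1 h2 T A hA hS
    by_contra! hlt
    obtain ⟨f, hf, hlt'⟩ := h1 T A hA hlt.le
    have a := A.adv_sub_samplingError_le f
    have b := hS f
    have d : succQ - 1 / n ≤ adv f := hf
    linarith
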